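/- Let $X$ be a projective, irreducible, non-singular curve over an algebraically closed field $k$, with function field $\Sigma$. For each closed point $x$ of $X$ let $K_x$ be the completion of $\Sigma$ at the normalized discrete valuation $\upsilon_x$ of $x$, and $A_x\subset K_x$ its ring of integers, i.e. the completion of the local ring $\mathcal O_{X,x}$. Let $\mathbb A_X=\{(\alpha_x)_x\in\prod_x K_x:\alpha_x\in A_x\text{ for almost all }x\}$ be the adele ring, the index $x$ running over the closed points of $X$, and let $\mathbb I_X=\mathbb A_X^*$. Let $p$ be a prime different from $\operatorname{char}k$, let $\mathcal C_p$ be a group of order $p$, and fix a nontrivial character $\chi:\mathcal C_p\to k^*$ (whose values lie in $\mu_p(k)$); $k$ is embedded in each $K_x$, and diagonally in $\mathbb A_X$. For a commutative ring $R$ and a finite abelian group $G$, a $G$-Galois extension of $R$ is a commutative ring extension $S$ of $R$ with a faithful action of $G$ by $R$-algebra automorphisms such that $S^G=R$, $S$ is separable over $R$ (projective as an $S\otimes_R S$-module), and the elements of $G$ are pairwise strongly distinct (for $g\ne h$ in $G$ and every nonzero idempotent $e\in S$ there is $s\in S$ with $g(s)e\neq h(s)e$). Let $\mathrm H(R,G)$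 be the set of $G$-Galois extensions of $R$ up to $G$-equivariant $R$-algebra isomorphism, with the Harrison product $S_1\cdot S_2=(S_1\otimes_R S_2)^{\{(g,g^{-1}):g\in G\}}$, on which $g$ acts as $g\otimes 1$. (When $R$ contains $k$ and $G=\mathcal C_p$ this is $\bigoplus_\psi S_1^\psi\otimes_R S_2^\psi$, where $\psi$ runs over the characters $\mathcal C_p\to\mu_p(k)$, $S^\psi=\{s\in S: g(s)=\psi(g)s\ \forall g\}$, and $g$ acts on the summand of index $\psi$ as $\psi(g)$.) For a ring $R\in\{\mathbb A_X\}\cup\{K_x\}_x$ and $u\in R^*$, let $R\{u\}=R[T]/(T^p-u)$ with the action of $\mathcal C_p$ given by $g(T)=\chi(g)T$. Then the sets $\mathrm H(\mathbb A_X,\mathcal C_p)$ and $\mathrm H(K_x,\mathcal C_p)$ are abelian groups under the Harrison product, and there is a commutative diagram of group homomorphisms $$\begin{array}{ccccc} \bigoplus_{x}\mathbb Z/(p) & \xleftarrow[\ \sim\ ]{\upsilon} & \mathbb I_X/\mathbb I_X^p & \xrightarrow[\ \sim\ ]{i} & \mathrm H(\mathbb A_X,\mathcal C_p)\\ \downarrow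 & & \downarrow & & \downarrow\\ \prod_{x}\mathbb Z/(p) & \xleftarrow[\ \sim\ ]{(\upsilon_x)_x} & \prod_x K_x^*/K_x^{*p} & \xrightarrow[\ \sim\ ]{(i_x)_x} & \prod_x\mathrm H(K_x,\mathcal C_p) \end{array}$$ in which all horizontal maps are isomorphisms (those in the bottom row for each $x$ separately) and all vertical maps are injective. Here $\upsilon$ sends the class of $u=(u_x)_x\in\mathbb I_X$ to $(\upsilon_x(u_x)\bmod p)_x$, the map $\upsilon_x$ is the valuation modulo $p$, the Kummer maps $i$ and $i_x$ send the class of $u\in\mathbb I_X$, respectively $u\in K_x^*$, to the class of $\mathbb A_X\{u\}$, respectively $K_x\{u\}$; the left vertical map is the inclusion, the middle one is induced by the projections $\mathbb A_X\to K_x$, and the right one by the base changes $S\mapsto S\otimes_{\mathbb A_X}K_x$. -/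

import Mathlib

open CategoryTheory AlgebraicGeometry IsDedekindDomain TensorProduct

universe u w

/-! ### Algebras with a group action, Galois extensions of rings, the Harrison set -/

/-- A commutative `R`-algebra with an action of `G` by `R`-algebra automorphisms. -/
structure GAlg (R : Type u) [CommRing R] (G : Type w) [CommGroup G] where
  carrier : Type u
  [commRing : CommRing carrier]
  [algebra : Algebra R carrier]
  [action : MulSemiringAction G carrier]
  [smulComm : SMulCommClass G R carrier]

namespace GAlg

attribute [instance] GAlg.commRing GAlg.algebra GAlg.action GAlg.smulComm

variable {R : Type u} [CommRing R] {G : Type w} [CommGroup G]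

/-- The `R`-algebra endomorphism of `S` given by an element of `G`. -/
noncomputable def act (S : GAlg R G) (g : G) : S.carrier →ₐ[R] S.carrier :=
  MulSemiringAction.toAlgHom R S.carrier g

/-- Equivariant isomorphism: an isomorphism of `R`-algebras commuting with the `G`-actions. -/
def Iso (S T : GAlg R G) : Prop :=
  ∃ φ : S.carrier ≃ₐ[R] T.carrier, ∀ (g : G) (s : S.carrier), φ (g • s) = g • φ s

theorem Iso.refl (S : GAlg R G) : S.Iso S := ⟨AlgEquiv.refl, fun _ _ => rfl⟩

theorem Iso.symm {S T : GAlg R G} : S.Iso T → T.Iso S := by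
  rintro ⟨φ, h⟩
  refine ⟨φ.symm, fun g t => ?_⟩
  apply φ.injective
  rw [h]
  simp

theorem Iso.trans {S T U : GAlg R G} : S.Iso T → T.Iso U → S.Iso U := by
  rintro ⟨φ, h⟩ ⟨ψ, h'⟩
  exact ⟨φ.trans ψ, fun g s => by simp [h, h']⟩

instance setoid (R : Type u) [CommRing R] (G : Type w) [CommGroup G] : Setoid (GAlg R G) where
  r := Iso
  iseqv := ⟨Iso.refl, Iso.symm, Iso.trans⟩

/-- A commutative `R`-algebra `S` is separable if it is projective as a module over `S ⊗[R] S`,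
which acts on `S` through the multiplication map. -/
def IsSeparableAlgebra (R : Type u) (S : Type u) [CommRing R] [CommRing S] [Algebra R S] : Prop :=
  letI : Module (S ⊗[R] S) S :=
    Module.compHom S (Algebra.TensorProduct.lmul' R (S := S)).toRingHom
  Module.Projective (S ⊗[R] S) S

/-- `S` is a `G`-Galois extension of `R`. -/
structure IsGalois (S : GAlg R G) : Prop where
  /-- `S` is a ring extension of `R`. -/
  injective : Function.Injective (algebraMap R S.carrier)
  /-- `G` acts faithfully. -/
  faithful : FaithfulSMul G S.carrier
  /-- The ring of invariants is `R`. -/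
  invariants : ∀ s : S.carrier, (∀ g : G, g • s = s) → s ∈ (algebraMap R S.carrier).range
  /-- `S` is a separable `R`-algebra. -/
  separable : IsSeparableAlgebra R S.carrier
  /-- The elements of `G` are pairwise strongly distinct. -/
  stronglyDistinct : ∀ g h : G, g ≠ h → ∀ e : S.carrier, IsIdempotentElem e → e ≠ 0 →
    ∃ s : S.carrier, (g • s) * e ≠ (h • s) * e

/-! #### The Harrison product -/

/-- The elements of `S ⊗ T` invariant under all `(g, g⁻¹)`, `g ∈ G`. -/
noncomputable def harrisonSubalgebra (S T : GAlg R G) :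
    Subalgebra R (S.carrier ⊗[R] T.carrier) where
  carrier := {z | ∀ g : G, Algebra.TensorProduct.map (S.act g) (T.act g⁻¹) z = z}
  mul_mem' ha hb g := by rw [map_mul, ha g, hb g]
  add_mem' ha hb g := by rw [map_add, ha g, hb g]
  algebraMap_mem' r g := AlgHom.commutes _ r

theorem act_one (S : GAlg R G) : S.act 1 = AlgHom.id R S.carrier := by
  ext s; simp [act]

theorem act_mul (S : GAlg R G) (g h : G) : S.act (g * h) = (S.act g).comp (S.act h) := by
  ext s; simp [act, mul_smul]

theorem map_act_mem (S T : GAlg R G) (g : G) {z : S.carrier ⊗[R] T.carrier}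
    (hz : z ∈ harrisonSubalgebra S T) :
    Algebra.TensorProduct.map (S.act g) (AlgHom.id R T.carrier) z ∈ harrisonSubalgebra S T := by
  intro h
  conv_rhs => rw [← hz h]
  rw [← AlgHom.comp_apply, ← AlgHom.comp_apply, ← Algebra.TensorProduct.map_comp,
    ← Algebra.TensorProduct.map_comp, ← act_mul, ← act_mul, mul_comm]
  rfl

/-- The Harrison product `S · T = (S ⊗ T)^{(g, g⁻¹)}`, on which `g` acts as `g ⊗ 1`
(equivalently, as `1 ⊗ g`). When `R` contains `1/|G|` and sufficiently many roots of unity this is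
the direct sum of the products `S^χ ⊗ T^χ` of eigenspaces, with `g` acting on the summand of index
`χ` as `χ(g)`. -/
noncomputable def harrisonProd (S T : GAlg R G) : GAlg R G :=
  letI : MulSemiringAction G (harrisonSubalgebra S T) :=
    { smul := fun g z => ⟨Algebra.TensorProduct.map (S.act g) (AlgHom.id R T.carrier) z.1,
        map_act_mem S T g z.2⟩
      one_smul := fun z => Subtype.ext (by
        change Algebra.TensorProduct.map (S.act 1) (AlgHom.id R T.carrier) z.1 = z.1
        rw [act_one, Algebra.TensorProduct.map_id]; rfl)
      mul_smul := fun g h z => Subtype.ext (by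
        change Algebra.TensorProduct.map (S.act (g * h)) (AlgHom.id R T.carrier) z.1 =
          Algebra.TensorProduct.map (S.act g) (AlgHom.id R T.carrier)
            (Algebra.TensorProduct.map (S.act h) (AlgHom.id R T.carrier) z.1)
        rw [act_mul, ← AlgHom.comp_apply, ← Algebra.TensorProduct.map_comp]; rfl)
      smul_zero := fun g => Subtype.ext (map_zero _)
      smul_add := fun g y z => Subtype.ext (map_add _ _ _)
      smul_one := fun g => Subtype.ext (map_one _)
      smul_mul := fun g y z => Subtype.ext (map_mul _ _ _) }
  haveI : SMulCommClass G R (harrisonSubalgebra S T) :=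
    ⟨fun g r z => Subtype.ext (map_smul (Algebra.TensorProduct.map (S.act g)
      (AlgHom.id R T.carrier)) r z.1)⟩
  { carrier := harrisonSubalgebra S T }

theorem Iso.harrisonProd {S S' T T' : GAlg R G} :
    S.Iso S' → T.Iso T' → (harrisonProd S T).Iso (harrisonProd S' T') := by
  rintro ⟨φ, hφ⟩ ⟨ψ, hψ⟩
  let Φ := Algebra.TensorProduct.congr φ ψ
  have key : ∀ (g h : G) (z : S.carrier ⊗[R] T.carrier),
      Φ (Algebra.TensorProduct.map (S.act g) (T.act h) z) =
        Algebra.TensorProduct.map (S'.act g) (T'.act h) (Φ z) := by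
    intro g h z
    induction z using TensorProduct.induction_on with
    | zero => simp
    | tmul s t => simp [Φ, act, hφ, hψ]
    | add y z hy hz => simp only [map_add, hy, hz]
  have hmem : ∀ z, z ∈ harrisonSubalgebra S T ↔ Φ z ∈ harrisonSubalgebra S' T' := by
    intro z
    refine forall_congr' fun g => ?_
    rw [← key, Φ.injective.eq_iff]
  let E : harrisonSubalgebra S T ≃ₐ[R] harrisonSubalgebra S' T' :=
    AlgEquiv.ofBijective
      ((Φ.toAlgHom.comp (harrisonSubalgebra S T).val).codRestrict (harrisonSubalgebra S' T')
        fun z => (hmem z.1).1 z.2)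
      ⟨fun y z h => Subtype.ext (Φ.injective (congrArg Subtype.val h)), fun z => by
        obtain ⟨y, hy⟩ := Φ.surjective z.1
        exact ⟨⟨y, (hmem y).2 (hy ▸ z.2)⟩, Subtype.ext hy⟩⟩
  refine ⟨E, fun g z => Subtype.ext ?_⟩
  have := key g 1 z.1
  rw [act_one, act_one] at this
  exact this

/-! #### Base change -/

/-- The base change `R' ⊗[R] S` of `S`, with `G` acting through `S`. -/
noncomputable def baseChange (R' : Type u) [CommRing R'] [Algebra R R'] (S : GAlg R G) :
    GAlg R' G :=
  letI : MulSemiringAction G (R' ⊗[R] S.carrier) :=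
    { smul := fun g => Algebra.TensorProduct.map (AlgHom.id R' R') (S.act g)
      one_smul := fun z => by
        change Algebra.TensorProduct.map (AlgHom.id R' R') (S.act 1) z = z
        rw [act_one, Algebra.TensorProduct.map_id]; rfl
      mul_smul := fun g h z => by
        change Algebra.TensorProduct.map (AlgHom.id R' R') (S.act (g * h)) z =
          Algebra.TensorProduct.map (AlgHom.id R' R') (S.act g)
            (Algebra.TensorProduct.map (AlgHom.id R' R') (S.act h) z)
        rw [act_mul, ← AlgHom.comp_apply, ← Algebra.TensorProduct.map_comp]; rfl
      smul_zero := fun g => map_zero _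
      smul_add := fun g y z => map_add _ _ _
      smul_one := fun g => map_one _
      smul_mul := fun g y z => map_mul _ _ _ }
  haveI : SMulCommClass G R' (R' ⊗[R] S.carrier) :=
    ⟨fun g r z => map_smul (Algebra.TensorProduct.map (AlgHom.id R' R') (S.act g)) r z⟩
  { carrier := R' ⊗[R] S.carrier }

theorem Iso.baseChange (R' : Type u) [CommRing R'] [Algebra R R'] {S T : GAlg R G} :
    S.Iso T → (S.baseChange R').Iso (T.baseChange R') := by
  rintro ⟨φ, hφ⟩
  refine ⟨Algebra.TensorProduct.congr (AlgEquiv.refl (R := R') (A₁ := R')) φ, fun g z => ?_⟩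
  change Algebra.TensorProduct.congr (AlgEquiv.refl (R := R') (A₁ := R')) φ
      (Algebra.TensorProduct.map (AlgHom.id R' R') (S.act g) z) =
    Algebra.TensorProduct.map (AlgHom.id R' R') (T.act g)
      (Algebra.TensorProduct.congr (AlgEquiv.refl (R := R') (A₁ := R')) φ z)
  change R' ⊗[R] S.carrier at z
  induction z using TensorProduct.induction_on with
  | zero => simp
  | tmul s t => simp [act, hφ]
  | add y z hy hz => simp only [map_add, hy, hz]

/-! #### Kummer extensions -/

open Polynomial in
/-- The endomorphism `T ↦ ζ T` of `R[T]/(Tⁿ - u)` for an `n`-th root of unity `ζ`. -/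
noncomputable def kummerAct (n : ℕ) (u : Rˣ) (ζ : rootsOfUnity n R) :
    AdjoinRoot (X ^ n - C (u : R)) →ₐ[R] AdjoinRoot (X ^ n - C (u : R)) :=
  AdjoinRoot.liftAlgHom _ (Algebra.ofId R _)
    (algebraMap R _ ((ζ : Rˣ) : R) * AdjoinRoot.root (X ^ n - C (u : R))) (by
      have h1 : (((ζ : Rˣ) : R)) ^ n = 1 := by
        rw [← Units.val_pow_eq_pow_val, (mem_rootsOfUnity n _).1 ζ.2, Units.val_one]
      have h2 := AdjoinRoot.eval₂_root (X ^ n - C (u : R))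
      simp only [eval₂_sub, eval₂_pow, eval₂_X, eval₂_C] at h2 ⊢
      rw [mul_pow, ← map_pow, h1, map_one, one_mul]
      exact h2)

open Polynomial in
/-- The Kummer extension `R{u} = R[T]/(Tⁿ - u)`, on which `g ∈ G` acts by `g(T) = χ(g) T`. -/
noncomputable def kummer (n : ℕ) (χ : G →* rootsOfUnity n R) (u : Rˣ) : GAlg R G :=
  letI : MulSemiringAction G (AdjoinRoot (X ^ n - C (u : R))) :=
    { smul := fun g => kummerAct n u (χ g)
      one_smul := fun z => by
        change kummerAct n u (χ 1) z = AlgHom.id R _ z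
        congr 1
        apply AdjoinRoot.algHom_ext
        simp [kummerAct]
      mul_smul := fun g h z => by
        change kummerAct n u (χ (g * h)) z =
          ((kummerAct n u (χ g)).comp (kummerAct n u (χ h))) z
        congr 1
        apply AdjoinRoot.algHom_ext
        simp only [kummerAct, map_mul, AdjoinRoot.liftAlgHom_root, AlgHom.comp_apply,
          AlgHom.commutes, Subgroup.coe_mul, Units.val_mul]
        ring
      smul_zero := fun g => map_zero _
      smul_add := fun g y z => map_add _ _ _
      smul_one := fun g => map_one _
      smul_mul := fun g y z => map_mul _ _ _ }
  haveI : SMulCommClass G R (AdjoinRoot (X ^ n - C (u : R))) :=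
    ⟨fun g r z => map_smul (kummerAct n u (χ g)) r z⟩
  { carrier := AdjoinRoot (X ^ n - C (u : R)) }

end GAlg

/-- Equivariant isomorphism classes of commutative `R`-algebras with `G`-action. -/
abbrev GAlgClass (R : Type u) [CommRing R] (G : Type w) [CommGroup G] :=
  Quotient (GAlg.setoid R G)

/-- The Harrison product of isomorphism classes. -/
noncomputable def GAlgClass.harrisonMul {R : Type u} [CommRing R] {G : Type w} [CommGroup G] :
    GAlgClass R G → GAlgClass R G → GAlgClass R G :=
  Quotient.map₂ GAlg.harrisonProd fun _ _ h _ _ h' => GAlg.Iso.harrisonProd h h'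

/-- Base change of isomorphism classes. -/
noncomputable def GAlgClass.baseChange {R : Type u} [CommRing R] (R' : Type u) [CommRing R']
    [Algebra R R'] {G : Type w} [CommGroup G] : GAlgClass R G → GAlgClass R' G :=
  Quotient.map (GAlg.baseChange R') fun _ _ h => GAlg.Iso.baseChange R' h

/-- The Harrison set of `(R, G)`: the `G`-isomorphism classes of `G`-Galois extensions of `R`. -/
def Harrison (R : Type u) [CommRing R] (G : Type w) [CommGroup G] :=
  {c : GAlgClass R G // ∃ S : GAlg R G, S.IsGalois ∧ ⟦S⟧ = c}

/-- A commutative group structure on the Harrison set whose multiplication is the Harrison product.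
There is at most one, since a group structure is determined by its multiplication. -/
class HarrisonGroup (R : Type u) [CommRing R] (G : Type w) [CommGroup G] extends
    CommGroup (Harrison R G) where
  val_mul : ∀ a b : Harrison R G, (a * b).1 = GAlgClass.harrisonMul a.1 b.1

/-! ### The quotients `Rˣ / Rˣᵖ` -/

/-- The group `Rˣ / (Rˣ)ᵖ`. -/
abbrev PowQuot (R : Type u) [CommRing R] (p : ℕ) :=
  Rˣ ⧸ (powMonoidHom p : Rˣ →* Rˣ).range

/-- The homomorphism `Rˣ / (Rˣ)ᵖ → Sˣ / (Sˣ)ᵖ` induced by a ring homomorphism. -/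
def PowQuot.map {R S : Type u} [CommRing R] [CommRing S] (f : R →+* S) (p : ℕ) :
    PowQuot R p →* PowQuot S p :=
  QuotientGroup.map _ _ (Units.map (f : R →* S)) (by
    rintro _ ⟨v, rfl⟩
    exact ⟨Units.map (f : R →* S) v, by simp⟩)

/-! ### Curves and their adele rings -/

namespace AlgebraicGeometry

/-- `X` is integral, of dimension one, and all its local rings are regular. -/
class IsNonsingularCurve (X : Scheme.{u}) : Prop extends IsIntegral X where
  dim_eq_one : topologicalKrullDim X = 1
  regular : ∀ x : X, IsRegularLocalRing (X.presheaf.stalk x)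

namespace Curve

variable (X : Scheme.{u}) [IsNonsingularCurve X]

theorem ringKrullDim_stalk (x : closedPoints X) : ringKrullDim (X.presheaf.stalk x.1) = 1 := by
  let _ : PartialOrder X := specializationOrder X
  have hdim : Order.krullDim X = 1 := by
    rw [← IsNonsingularCurve.dim_eq_one (X := X), topologicalKrullDim]
    exact (Order.krullDim_eq_of_orderIso (irreducibleSetEquivPoints (α := X))).symm
  have hle : ((Order.coheight x.1 : ℕ∞) : WithBot ℕ∞) ≤ 1 :=
    hdim ▸ Order.coheight_le_krullDim x.1
  have hne : Order.coheight x.1 ≠ 0 := by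
    intro h0
    have hmax := Order.coheight_eq_zero.1 h0
    have hgen : genericPoint X = x.1 :=
      (hmax.eq_of_le ((genericPoint_spec X).specializes trivial)).symm
    have huniv : closure {x.1} = (Set.univ : Set X) := hgen ▸ genericPoint_closure X
    rw [IsClosed.closure_eq x.2] at huniv
    have hsub : Subsingleton X := ⟨fun a b => by
      have ha : a ∈ ({x.1} : Set X) := huniv ▸ Set.mem_univ a
      have hb : b ∈ ({x.1} : Set X) := huniv ▸ Set.mem_univ b
      rw [Set.mem_singleton_iff.1 ha, Set.mem_singleton_iff.1 hb]⟩
    have h := Order.krullDim_nonpos_of_subsingleton (α := X)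
    rw [hdim] at h
    exact absurd h (by decide)
  have heq : Order.coheight x.1 = 1 :=
    le_antisymm (by exact_mod_cast hle) (Order.one_le_iff_ne_zero.2 hne)
  have := ringKrullDim_stalk_eq_coheight x.1
  rw [this]
  exact congrArg _ heq

instance (x : closedPoints X) : IsDiscreteValuationRing (X.presheaf.stalk x.1) := by
  have hreg := IsNonsingularCurve.regular x.1
  rw [← IsLocalRing.finrank_CotangentSpace_eq_one_iff]
  have h := (IsRegularLocalRing.iff_finrank_cotangentSpace (X.presheaf.stalk x.1)).1 hreg
  rw [ringKrullDim_stalk] at h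
  exact_mod_cast h

/-- The closed point `x`, as the height one prime `𝔪ₓ` of the discrete valuation ring `𝒪ₓ`. -/
noncomputable def place (x : closedPoints X) : HeightOneSpectrum (X.presheaf.stalk x.1) where
  asIdeal := IsLocalRing.maximalIdeal _
  isPrime := inferInstance
  ne_bot := IsDiscreteValuationRing.not_a_field _

/-- `Kₓ`: the completion of the function field at the valuation `vₓ` of the closed point `x`. -/
abbrev K (x : closedPoints X) : Type u := (place X x).adicCompletion X.functionField

/-- `Aₓ`: the ring of integers of `Kₓ`, i.e. the completion of the local ring `𝒪ₓ`. -/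
noncomputable abbrev A (x : closedPoints X) : ValuationSubring (K X x) :=
  (place X x).adicCompletionIntegers X.functionField

/-- The normalized valuation `vₓ` on `Kₓˣ`, a uniformizer having valuation `1`. -/
noncomputable def ord (x : closedPoints X) (a : (K X x)ˣ) : ℤ :=
  -WithZero.log (Valued.v (a : K X x))

/-- The adele ring: the restricted product of the `Kₓ` with respect to the `Aₓ`, over the closed
points of `X`. -/
abbrev Adele : Type u :=
  RestrictedProduct (fun x : closedPoints X => K X x) (fun x => (A X x : Set (K X x)))
    Filter.cofinite

/-- The projection of the adele ring to `Kₓ`. -/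
noncomputable def proj (x : closedPoints X) : Adele X →+* K X x :=
  RestrictedProduct.evalRingHom (fun x : closedPoints X => K X x) x

noncomputable instance (x : closedPoints X) : Algebra (Adele X) (K X x) := (proj X x).toAlgebra

variable {X} {k : Type u} [Field k] (f : X ⟶ Spec (CommRingCat.of k))

/-- The structure map `k → 𝒪ₓ` of a curve over `k`. -/
noncomputable def constStalk (x : X) : k →+* X.presheaf.stalk x :=
  ((Scheme.ΓSpecIso (CommRingCat.of k)).inv ≫ f.appTop ≫ X.presheaf.germ ⊤ x trivial).hom

/-- The embedding `k → Aₓ`. -/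
noncomputable def constA (x : closedPoints X) : k →+* A X x :=
  (algebraMap (X.presheaf.stalk x.1) (A X x)).comp (constStalk f x.1)

/-- The embedding `k → Kₓ`. -/
noncomputable def constK (x : closedPoints X) : k →+* K X x :=
  (A X x).subtype.comp (constA f x)

/-- The diagonal embedding of `k` in the adele ring. -/
noncomputable def constAdele : k →+* Adele X where
  toFun c := ⟨fun x => constK f x c, Filter.Eventually.of_forall fun x => (constA f x c).2⟩
  map_one' := RestrictedProduct.ext _ _ fun x => map_one (constK f x)
  map_mul' a b := RestrictedProduct.ext _ _ fun x => map_mul (constK f x) a b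
  map_zero' := RestrictedProduct.ext _ _ fun x => map_zero (constK f x)
  map_add' a b := RestrictedProduct.ext _ _ fun x => map_add (constK f x) a b

end Curve

end AlgebraicGeometry

open AlgebraicGeometry.Curve

/-!
# Kummer theory over the adele ring of a curve

Let `R` be a ring in which `p` is invertible, and let `χ` be a character of the group `G` of order
`p` with values in the `p`-th roots of unity of `R` such that all `χ g - 1` with `g ≠ 1` are
invertible. An `R`-algebra `S` with an action of `G` is the direct sum of its eigenspaces `Sʲ` for
the powers `χʲ`, by the usual projections `p⁻¹ ∑ χ(g)⁻ʲ g`, and everything rests on one remark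
(`GAlg.kummer_iso`): if `S⁰ = R` and the eigenspace `S¹` contains a unit `t` of `S`, then `S` is the
Kummer extension `R{tᵖ}`. Applied to `T ⊗ T` in `R{u} · R{v}` and to `1 ⊗ T` in `R' ⊗ R{u}`, it
shows that `u ↦ R{u}` turns products into Harrison products and commutes with base change, and
applied to `c T` in `R{v}` it gives one half of `R{u} ≅ R{v} ↔ u / v ∈ Rˣᵖ`
(`GAlg.kummer_iso_kummer_iff`).

It remains to see that every Galois extension `S` has a unit in `S¹`. Separability provides an
element `∑ xᵢ ⊗ yᵢ` of `S ⊗ S` with `∑ xᵢ yᵢ = 1` and `∑ s xᵢ ⊗ yᵢ = ∑ xᵢ ⊗ s yᵢ`. Since the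
elements of `G` are strongly distinct, `∑ xᵢ g(yᵢ) = 0` for `g ≠ 1` (`GAlg.IsGalois.lmul'_map_act`), and
projecting to eigenspaces yields `1 = ∑ aᵢ bᵢ` with `aᵢ ∈ S¹` and `bᵢ ∈ S⁻¹`
(`GAlg.IsGalois.exists_sum_mul_eq_one`). So `S¹` is an invertible `R`-module. To find a generator it
is enough to weight the terms `aᵢ bᵢ ∈ R` with orthogonal idempotents `cᵢ ∈ R` so that
`∑ cᵢ aᵢ bᵢ` is a unit, because this sum is the product of `∑ cᵢ aᵢ` and `∑ cᵢ bᵢ`. Over a field a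
single nonzero term is selected; over the adele ring a term of valuation at least `1` is selected
at every place (`AlgebraicGeometry.Curve.selectsUnits_adele`). Hence `Rˣ / Rˣᵖ` is in bijection with
the Harrison set, which inherits its group structure.

On the side of valuations, the residue field of `Kₓ` is `k`, as `X` is of finite type over the
algebraically closed field `k`. By Hensel's lemma an element of `Kₓˣ` is therefore a `p`-th power
as soon as its valuation is divisible by `p`, and the roots of an idele, being integral units
wherever the idele is one, form an idele
(`AlgebraicGeometry.Curve.exists_pow_eq_iff_forall_dvd_ord`).
-/

/-! ### Characters and eigenspaces -/

section Characters

variable {R : Type u} [CommRing R] {G : Type w} [CommGroup G] {p : ℕ}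

/-- The value at `g` of the `j`-th power of the character `χ`, as an element of `R`. -/
def charPow (χ : G →* rootsOfUnity p R) (j : ℤ) (g : G) : R :=
  (((χ g : Rˣ) ^ j : Rˣ) : R)

/-- The conditions under which Kummer theory of exponent `p` works over `R`: `G` has prime order
`p`, which is invertible in `R`, and `χ` is strongly nontrivial, in that `χ g - 1` is not only
nonzero but invertible for `g ≠ 1`. -/
structure IsKummerChar (χ : G →* rootsOfUnity p R) : Prop where
  prime : p.Prime
  card : Nat.card G = p
  isUnit_natCast : IsUnit (p : R)
  isUnit_sub_one : ∀ g : G, g ≠ 1 → IsUnit (charPow χ 1 g - 1)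

variable (χ : G →* rootsOfUnity p R)

theorem charPow_zero (g : G) : charPow χ 0 g = 1 := by simp [charPow]

theorem charPow_add (i j : ℤ) (g : G) : charPow χ (i + j) g = charPow χ i g * charPow χ j g := by
  simp [charPow, zpow_add]

theorem charPow_one_right (j : ℤ) : charPow χ j 1 = 1 := by simp [charPow]

theorem charPow_mul (j : ℤ) (g h : G) : charPow χ j (g * h) = charPow χ j g * charPow χ j h := by
  simp [charPow, mul_zpow]

theorem charPow_neg_mul (j : ℤ) (g : G) : charPow χ (-j) g * charPow χ j g = 1 := by
  rw [← charPow_add, neg_add_cancel, charPow_zero]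

theorem charPow_inv (j : ℤ) (g : G) : charPow χ j g⁻¹ = charPow χ (-j) g := by
  simp [charPow]

theorem charPow_natCast (j : ℕ) (g : G) : charPow χ j g = charPow χ 1 g ^ j := by
  simp [charPow]

theorem charPow_zpow (j : ℤ) (g : G) : charPow χ 1 (g ^ j) = charPow χ j g := by
  simp [charPow]

variable {χ}

namespace IsKummerChar

theorem finite (hχ : IsKummerChar χ) : Finite G :=
  Nat.finite_of_card_ne_zero (hχ.card ▸ hχ.prime.ne_zero)

theorem charPow_one_pow (χ : G →* rootsOfUnity p R) (g : G) : charPow χ 1 g ^ p = 1 := by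
  have := (mem_rootsOfUnity p _).1 (χ g).2
  simp only [charPow, zpow_one]
  rw [← Units.val_pow_eq_pow_val, this, Units.val_one]

theorem sum_group (hχ : IsKummerChar χ) [Fintype G] {j : ℤ} (hj : ¬ (p : ℤ) ∣ j) :
    ∑ g : G, charPow χ j g = 0 := by
  have : Nontrivial G := by
    rw [← Finite.one_lt_card_iff_nontrivial, hχ.card]
    exact hχ.prime.one_lt
  obtain ⟨g, hg⟩ := exists_ne (1 : G)
  have : Fact p.Prime := ⟨hχ.prime⟩
  have hord : orderOf g = p := orderOf_eq_prime (by rw [← hχ.card, pow_card_eq_one']) hg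
  have hne : g ^ j ≠ 1 := by
    rwa [Ne, ← orderOf_dvd_iff_zpow_eq_one, hord]
  have hu := hχ.isUnit_sub_one _ hne
  rw [charPow_zpow] at hu
  rw [← hu.mul_right_eq_zero, sub_mul, one_mul, sub_eq_zero, Finset.mul_sum]
  simp_rw [← charPow_mul]
  exact Fintype.sum_equiv (Equiv.mulLeft g) _ _ fun _ => rfl

theorem sum_range (hχ : IsKummerChar χ) {g : G} (hg : g ≠ 1) :
    ∑ j ∈ Finset.range p, charPow χ (-(j : ℤ)) g = 0 := by
  have hu := hχ.isUnit_sub_one _ (inv_ne_one.2 hg)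
  rw [← hu.mul_left_eq_zero]
  simp_rw [← charPow_inv, charPow_natCast]
  rw [geom_sum_mul, charPow_one_pow, sub_self]

end IsKummerChar

end Characters

namespace GAlg

variable {R : Type u} [CommRing R] {G : Type w} [CommGroup G] {p : ℕ}

/-- The ring of invariants of `S` is `R`, and `R` is contained in `S`. -/
structure InvariantsEqBase (S : GAlg R G) : Prop where
  injective : Function.Injective (algebraMap R S.carrier)
  invariants : ∀ s : S.carrier, (∀ g : G, g • s = s) → s ∈ (algebraMap R S.carrier).range

theorem IsGalois.invariantsEqBase {S : GAlg R G} (hS : S.IsGalois) : S.InvariantsEqBase :=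
  ⟨hS.injective, hS.invariants⟩

/-- `s` lies in the `χʲ`-eigenspace of `S`. -/
def IsEigen (S : GAlg R G) (χ : G →* rootsOfUnity p R) (j : ℤ) (s : S.carrier) : Prop :=
  ∀ g : G, g • s = charPow χ j g • s

theorem act_apply (S : GAlg R G) (g : G) (s : S.carrier) : S.act g s = g • s := rfl

/-- The projection `|G|⁻¹ ∑ χ(g)⁻ʲ g` of `S` onto its `χʲ`-eigenspace. -/
noncomputable def eigenProj [Fintype G] (S : GAlg R G) (χ : G →* rootsOfUnity p R) (j : ℤ) :
    S.carrier →ₗ[R] S.carrier :=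
  Ring.inverse (p : R) • ∑ g : G, charPow χ (-j) g • (S.act g).toLinearMap

section Eigen

variable {S : GAlg R G} {χ : G →* rootsOfUnity p R}

theorem IsEigen.mul {i j : ℤ} {s t : S.carrier} (hs : S.IsEigen χ i s) (ht : S.IsEigen χ j t) :
    S.IsEigen χ (i + j) (s * t) := by
  intro g
  rw [smul_mul', hs, ht, smul_mul_smul_comm, charPow_add]

theorem isEigen_algebraMap (r : R) : S.IsEigen χ 0 (algebraMap R S.carrier r) := by
  intro g
  rw [charPow_zero, one_smul]
  exact (S.act g).commutes r

theorem IsEigen.smul {j : ℤ} {s : S.carrier} (hs : S.IsEigen χ j s) (r : R) :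
    S.IsEigen χ j (r • s) := by
  intro g
  rw [smul_comm, hs, smul_comm]

theorem IsEigen.sum {ι : Type*} {j : ℤ} (I : Finset ι) {s : ι → S.carrier}
    (hs : ∀ i ∈ I, S.IsEigen χ j (s i)) : S.IsEigen χ j (∑ i ∈ I, s i) := by
  intro g
  rw [Finset.smul_sum, Finset.smul_sum]
  exact Finset.sum_congr rfl fun i hi => hs i hi g

theorem IsEigen.pow {s : S.carrier} (hs : S.IsEigen χ 1 s) (n : ℕ) : S.IsEigen χ n (s ^ n) := by
  intro g
  rw [smul_pow', hs, smul_pow, charPow_natCast]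

/-- The inverse of a unit in the `χʲ`-eigenspace lies in the `χ⁻ʲ`-eigenspace. -/
theorem IsEigen.inv {j : ℤ} {t : S.carrierˣ} (ht : S.IsEigen χ j (t : S.carrier)) :
    S.IsEigen χ (-j) ((t⁻¹ : S.carrierˣ) : S.carrier) := by
  intro g
  have h1 : g • ((t⁻¹ : S.carrierˣ) : S.carrier) * (charPow χ j g • (t : S.carrier)) = 1 := by
    rw [← ht g, ← smul_mul', Units.inv_mul, smul_one]
  calc g • ((t⁻¹ : S.carrierˣ) : S.carrier)
      = g • ((t⁻¹ : S.carrierˣ) : S.carrier) * (charPow χ j g • (t : S.carrier)) *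
          (charPow χ (-j) g • ((t⁻¹ : S.carrierˣ) : S.carrier)) := by
        rw [mul_assoc, smul_mul_smul_comm, mul_comm (charPow χ j g), charPow_neg_mul, one_smul,
          Units.mul_inv, mul_one]
    _ = _ := by rw [h1, one_mul]

theorem eigenProj_apply [Fintype G] (j : ℤ) (s : S.carrier) :
    S.eigenProj χ j s = Ring.inverse (p : R) • ∑ g : G, charPow χ (-j) g • g • s := by
  simp [eigenProj, act_apply]

theorem isEigen_eigenProj [Fintype G] (j : ℤ) (s : S.carrier) :
    S.IsEigen χ j (S.eigenProj χ j s) := by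
  intro g
  rw [eigenProj_apply, smul_comm g, smul_comm (charPow χ j g)]
  refine congrArg (Ring.inverse (p : R) • ·) ?_
  rw [Finset.smul_sum, Finset.smul_sum]
  refine Fintype.sum_equiv (Equiv.mulLeft g) _ _ fun h => ?_
  rw [Equiv.coe_mulLeft, charPow_mul, smul_smul, ← mul_assoc, mul_comm (charPow χ j g),
    charPow_neg_mul, one_mul, mul_smul g h s, smul_comm g]

theorem IsEigen.eigenProj [Fintype G] (hχ : IsKummerChar χ) {j : ℤ} {s : S.carrier}
    (hs : S.IsEigen χ j s) : S.eigenProj χ j s = s := by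
  rw [eigenProj_apply]
  simp_rw [hs _, smul_smul, charPow_neg_mul, one_smul]
  rw [Finset.sum_const, Finset.card_univ, ← Nat.card_eq_fintype_card, hχ.card,
    ← Nat.cast_smul_eq_nsmul R, smul_smul, Ring.inverse_mul_cancel _ hχ.isUnit_natCast, one_smul]

theorem IsEigen.eigenProj_eq_zero [Fintype G] (hχ : IsKummerChar χ) {i j : ℤ} {s : S.carrier}
    (hs : S.IsEigen χ i s) (hij : ¬ (p : ℤ) ∣ i - j) : S.eigenProj χ j s = 0 := by
  rw [eigenProj_apply]
  simp_rw [hs _, smul_smul, ← charPow_add, ← Finset.sum_smul]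
  rw [neg_add_eq_sub, hχ.sum_group hij, zero_smul, smul_zero]

theorem sum_eigenProj [Fintype G] (hχ : IsKummerChar χ) (s : S.carrier) :
    ∑ j ∈ Finset.range p, S.eigenProj χ j s = s := by
  classical
  simp_rw [eigenProj_apply]
  rw [← Finset.smul_sum, Finset.sum_comm]
  simp_rw [← Finset.sum_smul]
  rw [Fintype.sum_eq_single 1 fun g hg => by rw [hχ.sum_range hg, zero_smul]]
  simp_rw [charPow_one_right]
  rw [Finset.sum_const, Finset.card_range, one_smul, smul_smul, nsmul_one,
    Ring.inverse_mul_cancel _ hχ.isUnit_natCast, one_smul]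

theorem InvariantsEqBase.mem_range (hS : S.InvariantsEqBase) {s : S.carrier}
    (hs : S.IsEigen χ 0 s) : s ∈ (algebraMap R S.carrier).range :=
  hS.invariants s fun g => by rw [hs g, charPow_zero, one_smul]

/-- The averaging projection onto the invariants, as a linear retraction of `S` onto `R`. -/
theorem InvariantsEqBase.exists_retraction [Fintype G] (hχ : IsKummerChar χ)
    (hS : S.InvariantsEqBase) : ∃ ρ : S.carrier →ₗ[R] R,
      (∀ s, algebraMap R S.carrier (ρ s) = S.eigenProj χ 0 s) ∧
      ∀ r, ρ (algebraMap R S.carrier r) = r := by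
  have hinj : Function.Injective (Algebra.linearMap R S.carrier) := hS.injective
  let e := LinearEquiv.ofInjective (Algebra.linearMap R S.carrier) hinj
  let π : S.carrier →ₗ[R] LinearMap.range (Algebra.linearMap R S.carrier) :=
    (S.eigenProj χ 0).codRestrict _ fun s => hS.mem_range (isEigen_eigenProj 0 s)
  have key : ∀ s, algebraMap R S.carrier (e.symm (π s)) = S.eigenProj χ 0 s := fun s => by
    have := congrArg Subtype.val (e.apply_symm_apply (π s))
    exact this
  refine ⟨e.symm.toLinearMap ∘ₗ π, key, fun r => hS.injective ?_⟩
  exact (key _).trans ((isEigen_algebraMap r).eigenProj hχ)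

end Eigen

end GAlg

/-! ### Kummer extensions -/

namespace GAlg

variable {R : Type u} [CommRing R] {G : Type w} [CommGroup G] {p : ℕ}

section Kummer

open Polynomial

variable (χ : G →* rootsOfUnity p R) (u : Rˣ)

/-- The class of `T` in `R{u} = R[T]/(Tᵖ - u)`. -/
noncomputable def kummerRoot : (kummer p χ u).carrier :=
  AdjoinRoot.root (X ^ p - C (u : R))

theorem kummerRoot_pow :
    kummerRoot χ u ^ p = algebraMap R (kummer p χ u).carrier u := by
  have h := AdjoinRoot.eval₂_root (X ^ p - C (u : R))
  simp only [eval₂_sub, eval₂_pow, eval₂_X, eval₂_C] at h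
  exact sub_eq_zero.1 h

theorem isEigen_kummerRoot : (kummer p χ u).IsEigen χ 1 (kummerRoot χ u) := by
  intro g
  change kummerAct p u (χ g) (AdjoinRoot.root (X ^ p - C (u : R))) = _
  rw [kummerAct, AdjoinRoot.liftAlgHom_root, Algebra.smul_def]
  simp only [charPow, zpow_one]
  rfl

variable {χ}

theorem isUnit_kummerRoot (hp : p ≠ 0) : IsUnit (kummerRoot χ u) := by
  rw [← isUnit_pow_iff hp, kummerRoot_pow]
  exact u.isUnit.map _

theorem exists_eq_sum_kummerRoot (hp : p ≠ 0) (z : (kummer p χ u).carrier) :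
    ∃ c : ℕ → R, z = ∑ i ∈ Finset.range p, c i • kummerRoot χ u ^ i := by
  have hm : (X ^ p - C (u : R)).Monic := monic_X_pow_sub_C _ hp
  obtain ⟨f, hf⟩ := AdjoinRoot.mk_surjective (g := X ^ p - C (u : R)) z
  rcases subsingleton_or_nontrivial R with h | h
  · have : Subsingleton (kummer p χ u).carrier := Module.subsingleton R _
    exact ⟨0, Subsingleton.elim _ _⟩
  have hdeg : (f %ₘ (X ^ p - C (u : R))).natDegree < p := by
    have := natDegree_modByMonic_lt f hm (by
      intro h1
      have h2 := congrArg natDegree h1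
      rw [natDegree_X_pow_sub_C, natDegree_one] at h2
      exact hp h2)
    rwa [natDegree_X_pow_sub_C] at this
  refine ⟨(f %ₘ (X ^ p - C (u : R))).coeff, ?_⟩
  have hmod : AdjoinRoot.mk (X ^ p - C (u : R)) (f %ₘ (X ^ p - C (u : R))) =
      AdjoinRoot.mk (X ^ p - C (u : R)) f := by
    rw [AdjoinRoot.mk_eq_mk, modByMonic_eq_sub_mul_div, sub_sub_cancel_left, dvd_neg]
    exact dvd_mul_right _ _
  rw [← hf, ← hmod]
  conv_lhs => rw [as_sum_range' _ p hdeg]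
  rw [map_sum]
  refine Finset.sum_congr rfl fun i _ => ?_
  rw [← C_mul_X_pow_eq_monomial, map_mul, map_pow, AdjoinRoot.mk_X, AdjoinRoot.mk_C,
    Algebra.smul_def]
  rfl

theorem algebraMap_kummer_injective (hp : p ≠ 0) :
    Function.Injective (algebraMap R (kummer p χ u).carrier) := by
  have hm : (X ^ p - C (u : R)).Monic := monic_X_pow_sub_C _ hp
  rw [injective_iff_map_eq_zero]
  intro r hr
  change AdjoinRoot.of _ r = 0 at hr
  rw [← AdjoinRoot.mk_C, AdjoinRoot.mk_eq_zero] at hr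
  by_contra h
  have : Nontrivial R := nontrivial_of_ne _ _ h
  refine hm.not_dvd_of_natDegree_lt (C_ne_zero.2 h) ?_ hr
  rw [natDegree_C, natDegree_X_pow_sub_C]
  exact Nat.pos_of_ne_zero hp

/-- The `χʲ`-eigenspace of `R{u}` is spanned by `Tʲ`. -/
theorem IsEigen.exists_eq_smul_kummerRoot (hχ : IsKummerChar χ) {j : ℕ} (hj : j < p)
    {z : (kummer p χ u).carrier} (hz : (kummer p χ u).IsEigen χ j z) :
    ∃ c : R, z = c • kummerRoot χ u ^ j := by
  have := hχ.finite
  have := Fintype.ofFinite G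
  obtain ⟨c, hc⟩ := exists_eq_sum_kummerRoot u hχ.prime.ne_zero z
  refine ⟨c j, ?_⟩
  have hpow (i : ℕ) := (isEigen_kummerRoot χ u).pow i
  rw [← hz.eigenProj hχ]
  conv_lhs => rw [hc]
  rw [map_sum, Finset.sum_eq_single j]
  · exact ((hpow j).smul _).eigenProj hχ
  · intro i hi hij
    refine ((hpow i).smul _).eigenProj_eq_zero hχ fun hdvd => hij ?_
    have hi := Finset.mem_range.1 hi
    have := Int.eq_zero_of_abs_lt_dvd hdvd (by rw [abs_lt]; omega)
    omega
  · intro h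
    exact absurd (Finset.mem_range.2 hj) h

theorem invariantsEqBase_kummer (hχ : IsKummerChar χ) : (kummer p χ u).InvariantsEqBase where
  injective := algebraMap_kummer_injective u hχ.prime.ne_zero
  invariants s hs := by
    have h0 : (kummer p χ u).IsEigen χ (0 : ℕ) s := fun g => by
      rw [Nat.cast_zero, charPow_zero, one_smul, hs]
    obtain ⟨c, hc⟩ := h0.exists_eq_smul_kummerRoot u hχ hχ.prime.pos
    exact ⟨c, by rw [hc, pow_zero, Algebra.smul_def, mul_one]⟩

/-- An algebra with invariants `R` and an invertible element `t` in its `χ`-eigenspace is the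
Kummer extension `R{tᵖ}`. -/
theorem kummer_iso (hχ : IsKummerChar χ) {S : GAlg R G} (hS : S.InvariantsEqBase)
    {t : S.carrier} (ht : IsUnit t) (hte : S.IsEigen χ 1 t)
    (htu : t ^ p = algebraMap R S.carrier u) : (kummer p χ u).Iso S := by
  have := hχ.finite
  have := Fintype.ofFinite G
  obtain ⟨t, rfl⟩ := ht
  let φ : AdjoinRoot (X ^ p - C (u : R)) →ₐ[R] S.carrier :=
    AdjoinRoot.liftAlgHom _ (Algebra.ofId R _) (t : S.carrier) (by
      simp only [eval₂_sub, eval₂_pow, eval₂_X, eval₂_C]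
      rw [htu]
      exact sub_self _)
  have hroot : φ (kummerRoot χ u) = t := AdjoinRoot.liftAlgHom_root _ _ _ _
  have hequi : ∀ (g : G) (z : (kummer p χ u).carrier), φ (g • z) = g • φ z := by
    intro g z
    have : φ.comp ((kummer p χ u).act g) = (S.act g).comp φ := by
      apply AdjoinRoot.algHom_ext
      change φ (g • kummerRoot χ u) = g • φ (kummerRoot χ u)
      rw [isEigen_kummerRoot χ u, hroot, hte g, ← hroot]
      exact map_smul φ _ _
    exact DFunLike.congr_fun this z
  have hproj (j : ℤ) (z : (kummer p χ u).carrier) :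
      S.eigenProj χ j (φ z) = φ ((kummer p χ u).eigenProj χ j z) := by
    rw [eigenProj_apply, eigenProj_apply]
    refine Eq.trans ?_ (map_smul φ _ _).symm
    refine congrArg (Ring.inverse (p : R) • ·) ?_
    refine Eq.trans ?_ (map_sum φ _ _).symm
    refine Finset.sum_congr rfl fun g _ => ?_
    rw [← hequi]
    exact (map_smul φ _ _).symm
  have hinj : Function.Injective φ := by
    rw [injective_iff_map_eq_zero]
    intro z hz
    change (kummer p χ u).carrier at z
    rw [← sum_eigenProj hχ z]
    refine Finset.sum_eq_zero fun j hj => ?_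
    obtain ⟨c, hc⟩ := (isEigen_eigenProj (S := kummer p χ u) (χ := χ) j z).exists_eq_smul_kummerRoot
      u hχ (Finset.mem_range.1 hj)
    have h0 := hproj j z
    rw [hz, map_zero, hc] at h0
    have h1 : (0 : S.carrier) = c • (t : S.carrier) ^ j := by
      rw [h0]
      refine (map_smul φ _ _).trans ?_
      rw [← hroot]
      exact congrArg (c • ·) (map_pow φ _ _)
    have h2 : algebraMap R S.carrier c = 0 := by
      rw [Algebra.smul_def, eq_comm, (t.isUnit.pow j).mul_left_eq_zero] at h1
      exact h1
    rw [hc, hS.injective (h2.trans (map_zero _).symm)]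
    exact zero_smul R _
  have hsurj : Function.Surjective φ := by
    intro s
    have hj (j : ℕ) : ∃ z, φ z = S.eigenProj χ j s := by
      have hE : S.IsEigen χ 0 (S.eigenProj χ j s * ((t⁻¹ : S.carrierˣ) : S.carrier) ^ j) := by
        have h := (isEigen_eigenProj (S := S) (χ := χ) (j : ℤ) s).mul
          (t := (((t ^ j)⁻¹ : S.carrierˣ) : S.carrier)) (j := -(j : ℤ))
          (IsEigen.inv (by rw [Units.val_pow_eq_pow_val]; exact hte.pow j))
        rw [add_neg_cancel, ← inv_pow, Units.val_pow_eq_pow_val] at h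
        exact h
      obtain ⟨r, hr⟩ := hS.mem_range hE
      refine ⟨algebraMap R (kummer p χ u).carrier r * kummerRoot χ u ^ j, ?_⟩
      refine (map_mul φ _ _).trans ?_
      refine (congrArg₂ (· * ·) (φ.commutes r) (map_pow φ _ _)).trans ?_
      rw [hroot, hr, mul_assoc, ← mul_pow, Units.inv_mul, one_pow, mul_one]
    choose z hz using hj
    exact ⟨∑ j ∈ Finset.range p, z j, by
      rw [map_sum]; simp_rw [hz]; exact sum_eigenProj hχ s⟩
  exact ⟨AlgEquiv.ofBijective φ ⟨hinj, hsurj⟩, hequi⟩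

/-- `R{u} ≅ R{v}` exactly when `u` and `v` agree modulo `p`-th powers. -/
theorem kummer_iso_kummer_iff (hχ : IsKummerChar χ) (u v : Rˣ) :
    (kummer p χ u).Iso (kummer p χ v) ↔ ∃ c : Rˣ, u = c ^ p * v := by
  have hp := hχ.prime.ne_zero
  constructor
  · rintro ⟨φ, hφ⟩
    have hE : (kummer p χ v).IsEigen χ (1 : ℕ) (φ (kummerRoot χ u)) := fun g => by
      rw [← hφ, Nat.cast_one, isEigen_kummerRoot χ u g, map_smul]
    obtain ⟨c, hc⟩ := hE.exists_eq_smul_kummerRoot v hχ hχ.prime.one_lt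
    have key : (u : R) = c ^ p * v := by
      apply algebraMap_kummer_injective (χ := χ) v hp
      rw [← φ.commutes, ← kummerRoot_pow, map_pow, hc, pow_one, _root_.smul_pow, kummerRoot_pow,
        Algebra.smul_def, map_mul]
    have hcu : IsUnit c := by
      rw [← isUnit_pow_iff hp]
      exact isUnit_of_mul_isUnit_left (key ▸ u.isUnit)
    obtain ⟨c, rfl⟩ := hcu
    exact ⟨c, Units.ext (by rw [key]; simp)⟩
  · rintro ⟨c, rfl⟩
    refine kummer_iso _ hχ (invariantsEqBase_kummer v hχ)
      (t := algebraMap R _ (c : R) * kummerRoot χ v)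
      ((c.isUnit.map _).mul (isUnit_kummerRoot v hp)) ?_ ?_
    · rw [← Algebra.smul_def]
      exact (isEigen_kummerRoot χ v).smul _
    · rw [mul_pow, kummerRoot_pow, ← map_pow, ← map_mul]
      simp

end Kummer

end GAlg

/-! ### Separability idempotents -/

section Separable

variable {R S : Type u} [CommRing R] [CommRing S] [Algebra R S]

/-- `e : S ⊗ S` is a separability idempotent: multiplication maps it to `1`, and both copies of `S`
act on it in the same way. -/
structure IsSeparabilityIdempotent (e : S ⊗[R] S) : Prop where
  lmul' : Algebra.TensorProduct.lmul' R (S := S) e = 1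
  tmul_one_mul : ∀ s : S, (s ⊗ₜ[R] (1 : S)) * e = ((1 : S) ⊗ₜ[R] s) * e

theorem IsSeparabilityIdempotent.lmul'_tmul_one_mul {e : S ⊗[R] S}
    (he : IsSeparabilityIdempotent e) (z : S ⊗[R] S) :
    (Algebra.TensorProduct.lmul' R (S := S) z ⊗ₜ[R] (1 : S)) * e = z * e := by
  induction z using TensorProduct.induction_on with
  | zero => simp
  | tmul x y =>
    calc _ = (x ⊗ₜ[R] (1 : S)) * ((y ⊗ₜ[R] (1 : S)) * e) := by
          rw [← mul_assoc, Algebra.TensorProduct.tmul_mul_tmul, one_mul,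
            Algebra.TensorProduct.lmul'_apply_tmul]
      _ = _ := by
          rw [he.tmul_one_mul, ← mul_assoc, Algebra.TensorProduct.tmul_mul_tmul, one_mul, mul_one]
  | add y z hy hz => rw [map_add, TensorProduct.add_tmul, add_mul, hy, hz, add_mul]

theorem IsSeparabilityIdempotent.isSeparableAlgebra {e : S ⊗[R] S}
    (he : IsSeparabilityIdempotent e) : GAlg.IsSeparableAlgebra R S := by
  unfold GAlg.IsSeparableAlgebra
  let _ : Module (S ⊗[R] S) S :=
    Module.compHom S (Algebra.TensorProduct.lmul' R (S := S)).toRingHom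
  have hsmul (z : S ⊗[R] S) (s : S) : z • s = Algebra.TensorProduct.lmul' R (S := S) z * s := rfl
  let i : S →ₗ[S ⊗[R] S] S ⊗[R] S :=
    { toFun := fun s => (s ⊗ₜ[R] (1 : S)) * e
      map_add' := fun s t => by rw [TensorProduct.add_tmul, add_mul]
      map_smul' := fun z s => by
        rw [hsmul, ← mul_one (1 : S), ← Algebra.TensorProduct.tmul_mul_tmul, mul_one, mul_comm,
          ← mul_assoc, mul_comm e, he.lmul'_tmul_one_mul, RingHom.id_apply, smul_eq_mul]
        ring }
  let m : S ⊗[R] S →ₗ[S ⊗[R] S] S :=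
    { toFun := fun z => Algebra.TensorProduct.lmul' R (S := S) z
      map_add' := map_add _
      map_smul' := fun y z => by
        rw [hsmul, smul_eq_mul, map_mul]; rfl }
  refine Module.Projective.of_split i m (LinearMap.ext fun s => ?_)
  change Algebra.TensorProduct.lmul' R (S := S) ((s ⊗ₜ[R] (1 : S)) * e) = s
  rw [map_mul, he.lmul', Algebra.TensorProduct.lmul'_apply_tmul, mul_one, mul_one]

theorem GAlg.IsSeparableAlgebra.exists_idempotent (h : GAlg.IsSeparableAlgebra R S) :
    ∃ e : S ⊗[R] S, IsSeparabilityIdempotent e := by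
  unfold GAlg.IsSeparableAlgebra at h
  let _ : Module (S ⊗[R] S) S :=
    Module.compHom S (Algebra.TensorProduct.lmul' R (S := S)).toRingHom
  have hsmul (z : S ⊗[R] S) (s : S) : z • s = Algebra.TensorProduct.lmul' R (S := S) z * s := rfl
  have _ : Module.Projective (S ⊗[R] S) S := h
  let m : S ⊗[R] S →ₗ[S ⊗[R] S] S :=
    { toFun := fun z => Algebra.TensorProduct.lmul' R (S := S) z
      map_add' := map_add _
      map_smul' := fun y z => by
        rw [hsmul, smul_eq_mul, map_mul]; rfl }
  obtain ⟨σ, hσ⟩ := Module.projective_lifting_property m LinearMap.id fun s =>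
    ⟨s ⊗ₜ[R] (1 : S), by
      change Algebra.TensorProduct.lmul' R (S := S) (s ⊗ₜ[R] (1 : S)) = s
      rw [Algebra.TensorProduct.lmul'_apply_tmul, mul_one]⟩
  refine ⟨σ 1, LinearMap.congr_fun hσ 1, fun s => ?_⟩
  rw [← smul_eq_mul, ← smul_eq_mul, ← map_smul, ← map_smul, hsmul, hsmul,
    Algebra.TensorProduct.lmul'_apply_tmul, Algebra.TensorProduct.lmul'_apply_tmul, mul_one s,
    one_mul s]

theorem IsSeparabilityIdempotent.isIdempotentElem {e : S ⊗[R] S}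
    (he : IsSeparabilityIdempotent e) : IsIdempotentElem e := by
  rw [IsIdempotentElem, ← he.lmul'_tmul_one_mul e, he.lmul', ← Algebra.TensorProduct.one_def,
    one_mul]

end Separable

namespace GAlg

variable {R : Type u} [CommRing R] {G : Type w} [CommGroup G] {p : ℕ}
  {χ : G →* rootsOfUnity p R}

theorem isUnit_charPow_sub (hχ : IsKummerChar χ) {g h : G} (hgh : g ≠ h) :
    IsUnit (charPow χ 1 g - charPow χ 1 h) := by
  have h1 := hχ.isUnit_sub_one (g * h⁻¹) (by rwa [Ne, mul_inv_eq_one])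
  have h2 : IsUnit (charPow χ 1 h) := Units.isUnit _
  have h3 := h1.mul h2
  rwa [sub_mul, ← charPow_mul, inv_mul_cancel_right, one_mul] at h3

/-- Kummer extensions are Galois: `p⁻¹ ∑ Tʲ ⊗ T⁻ʲ` is a separability idempotent. -/
theorem isGalois_kummer [Nontrivial R] (hχ : IsKummerChar χ) (u : Rˣ) :
    (kummer p χ u).IsGalois := by
  have hp := hχ.prime.ne_zero
  have hB := invariantsEqBase_kummer u hχ
  have hne : Nontrivial (kummer p χ u).carrier := hB.injective.nontrivial
  obtain ⟨t, ht⟩ := isUnit_kummerRoot (χ := χ) u hp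
  have hte := isEigen_kummerRoot χ u
  rw [← ht] at hte
  have htp : (t : (kummer p χ u).carrier) ^ p = algebraMap R _ (u : R) := by
    rw [ht, kummerRoot_pow]
  have htp' : (((t⁻¹ : (kummer p χ u).carrierˣ)) : (kummer p χ u).carrier) ^ p =
      algebraMap R _ ((u⁻¹ : Rˣ) : R) := by
    have h1 : t ^ p = Units.map (algebraMap R (kummer p χ u).carrier : R →* _) u := Units.ext htp
    rw [← Units.val_pow_eq_pow_val, inv_pow, h1, ← map_inv]
    rfl
  -- the terms with index `0` and `p` of `∑ Tʲ ⊗ T⁻ʲ` agree, so the sum absorbs `T ⊗ T⁻¹`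
  let S := (kummer p χ u).carrier
  let w : S ⊗[R] S := (t : S) ⊗ₜ[R] ((t⁻¹ : Sˣ) : S)
  have hw (j : ℕ) : w ^ j = ((t : S) ^ j) ⊗ₜ[R] (((t⁻¹ : Sˣ) : S) ^ j) :=
    Algebra.TensorProduct.tmul_pow _ _ _
  have hwp : w ^ p = 1 := by
    rw [hw, htp, htp', Algebra.algebraMap_eq_smul_one, TensorProduct.smul_tmul,
      Algebra.smul_def, ← map_mul, Units.mul_inv, map_one, Algebra.TensorProduct.one_def]
  have hwsum : w * ∑ j ∈ Finset.range p, w ^ j = ∑ j ∈ Finset.range p, w ^ j := by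
    have := mul_geom_sum w p
    rwa [hwp, sub_self, sub_mul, one_mul, sub_eq_zero] at this
  have hT : ((t : S) ⊗ₜ[R] (1 : S)) * ∑ j ∈ Finset.range p, w ^ j =
      ((1 : S) ⊗ₜ[R] (t : S)) * ∑ j ∈ Finset.range p, w ^ j := by
    conv_rhs => rw [← hwsum, ← mul_assoc, Algebra.TensorProduct.tmul_mul_tmul, one_mul,
      Units.mul_inv]
  have hTpow (i : ℕ) : (((t : S) ^ i) ⊗ₜ[R] (1 : S)) * ∑ j ∈ Finset.range p, w ^ j =
      ((1 : S) ⊗ₜ[R] ((t : S) ^ i)) * ∑ j ∈ Finset.range p, w ^ j := by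
    induction i with
    | zero => simp
    | succ i ih =>
      have h1 : (((t : S) ^ (i + 1)) ⊗ₜ[R] (1 : S)) =
          ((t : S) ⊗ₜ[R] (1 : S)) * (((t : S) ^ i) ⊗ₜ[R] (1 : S)) := by
        rw [Algebra.TensorProduct.tmul_mul_tmul, mul_one, pow_succ']
      have h2 : ((1 : S) ⊗ₜ[R] ((t : S) ^ (i + 1))) =
          ((1 : S) ⊗ₜ[R] ((t : S) ^ i)) * ((1 : S) ⊗ₜ[R] (t : S)) := by
        rw [Algebra.TensorProduct.tmul_mul_tmul, mul_one, pow_succ]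
      rw [h1, h2, mul_assoc, ih, mul_left_comm, hT, mul_assoc]
  have hsep : IsSeparabilityIdempotent
      (Ring.inverse (p : R) • ∑ j ∈ Finset.range p, w ^ j) := by
    refine ⟨?_, fun s => ?_⟩
    · rw [map_smul, map_sum]
      simp_rw [hw, Algebra.TensorProduct.lmul'_apply_tmul, ← mul_pow, Units.mul_inv, one_pow]
      rw [Finset.sum_const, Finset.card_range, ← Nat.cast_smul_eq_nsmul R, smul_smul,
        Ring.inverse_mul_cancel _ hχ.isUnit_natCast, one_smul]
    · obtain ⟨c, hc⟩ := exists_eq_sum_kummerRoot u hp s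
      rw [mul_smul_comm, mul_smul_comm, hc, TensorProduct.sum_tmul, TensorProduct.tmul_sum,
        Finset.sum_mul, Finset.sum_mul]
      refine congrArg (Ring.inverse (p : R) • ·) (Finset.sum_congr rfl fun i _ => ?_)
      rw [← ht, TensorProduct.tmul_smul, ← TensorProduct.smul_tmul', smul_mul_assoc,
        smul_mul_assoc]
      exact congrArg (c i • ·) (hTpow i)
  have hdist : ∀ g h : G, g ≠ h → ∀ e : S, e ≠ 0 → (g • (t : S)) * e ≠ (h • (t : S)) * e := by
    intro g h hgh e he heq
    apply he
    rw [hte g, hte h, ← sub_eq_zero, ← sub_mul, ← sub_smul, Algebra.smul_def] at heq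
    exact (((isUnit_charPow_sub hχ hgh).map (algebraMap R S)).mul t.isUnit).mul_right_eq_zero.1 heq
  exact
    { injective := hB.injective
      faithful := ⟨fun {g h} hgh => by
        by_contra hne
        exact hdist g h hne 1 one_ne_zero (by rw [hgh])⟩
      invariants := hB.invariants
      separable := hsep.isSeparableAlgebra
      stronglyDistinct := fun g h hgh e _ he => ⟨t, hdist g h hgh e he⟩ }

/-! ### Galois extensions are Kummer extensions -/

/-- The Galois condition of Chase, Harrison and Rosenberg: a separability idempotent `∑ xᵢ ⊗ yᵢ`
satisfies `∑ xᵢ g(yᵢ) = 0` for `g ≠ 1`. Indeed this element is an idempotent on which `1` and `g`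
act in the same way. -/
theorem IsGalois.lmul'_map_act {S : GAlg R G} (hS : S.IsGalois)
    {e : S.carrier ⊗[R] S.carrier} (he : IsSeparabilityIdempotent e) {g : G} (hg : g ≠ 1) :
    Algebra.TensorProduct.lmul' R (S := S.carrier)
      (Algebra.TensorProduct.map (AlgHom.id R S.carrier) (S.act g) e) = 0 := by
  by_contra hne
  let ψ : S.carrier ⊗[R] S.carrier →ₐ[R] S.carrier :=
    (Algebra.TensorProduct.lmul' R (S := S.carrier)).comp
      (Algebra.TensorProduct.map (AlgHom.id R S.carrier) (S.act g))
  have hψ (x y : S.carrier) : ψ (x ⊗ₜ[R] y) = x * g • y := by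
    simp [ψ, act_apply]
  obtain ⟨s, hs⟩ := hS.stronglyDistinct g 1 hg (ψ e)
    (he.isIdempotentElem.map ψ) hne
  apply hs
  have := congrArg ψ (he.tmul_one_mul s)
  rw [map_mul, map_mul, hψ, hψ, smul_one, mul_one, one_mul] at this
  rw [one_smul, this]

/-- In a Galois extension the product of the eigenspaces of `χ` and `χ⁻¹` is `R`. -/
theorem IsGalois.exists_sum_mul_eq_one (hχ : IsKummerChar χ) {S : GAlg R G} (hS : S.IsGalois) :
    ∃ (I : Finset (S.carrier × S.carrier)) (a b : S.carrier × S.carrier → S.carrier),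
      (∀ i, S.IsEigen χ 1 (a i)) ∧ (∀ i, S.IsEigen χ (-1) (b i)) ∧ ∑ i ∈ I, a i * b i = 1 := by
  classical
  have := hχ.finite
  have := Fintype.ofFinite G
  obtain ⟨e, he⟩ := hS.separable.exists_idempotent
  obtain ⟨I, hI⟩ := TensorProduct.exists_finset e
  have hdelta (g : G) : ∑ i ∈ I, i.1 * g • i.2 = if g = 1 then 1 else 0 := by
    have h1 : Algebra.TensorProduct.lmul' R (S := S.carrier)
        (Algebra.TensorProduct.map (AlgHom.id R S.carrier) (S.act g) e) =
        ∑ i ∈ I, i.1 * g • i.2 := by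
      rw [hI, map_sum, map_sum]
      simp [act_apply]
    rw [← h1]
    split_ifs with hg
    · rw [hg, act_one, Algebra.TensorProduct.map_id]
      exact he.lmul'
    · exact hS.lmul'_map_act he hg
  have hsum : ∑ i ∈ I, i.1 * S.eigenProj χ (-1) i.2 =
      algebraMap R S.carrier (Ring.inverse (p : R)) := by
    simp_rw [eigenProj_apply, mul_smul_comm, Finset.mul_sum, mul_smul_comm]
    rw [← Finset.smul_sum, Finset.sum_comm]
    simp_rw [← Finset.smul_sum, hdelta]
    simp [charPow_one_right, Algebra.algebraMap_eq_smul_one]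
  -- apply the projection to the invariants, which is linear over the eigenspace of `χ⁻¹`
  have hproj (x y : S.carrier) (hy : S.IsEigen χ (-1) y) :
      S.eigenProj χ 0 (x * y) = S.eigenProj χ 1 x * y := by
    rw [eigenProj_apply, eigenProj_apply, smul_mul_assoc, Finset.sum_mul]
    refine congrArg (Ring.inverse (p : R) • ·) (Finset.sum_congr rfl fun g _ => ?_)
    rw [neg_zero, charPow_zero, one_smul, smul_mul', hy g, mul_smul_comm,
      smul_mul_assoc (charPow χ (-1) g)]
  refine ⟨I, fun i => (p : R) • S.eigenProj χ 1 i.1, fun i => S.eigenProj χ (-1) i.2,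
    fun i => (isEigen_eigenProj _ _).smul _, fun i => isEigen_eigenProj _ _, ?_⟩
  have h2 := congrArg (S.eigenProj χ 0) hsum
  rw [map_sum, (isEigen_algebraMap _).eigenProj hχ] at h2
  simp_rw [hproj _ _ (isEigen_eigenProj _ _)] at h2
  simp_rw [smul_mul_assoc]
  rw [← Finset.smul_sum, h2, Algebra.smul_def, ← map_mul,
    Ring.mul_inverse_cancel _ hχ.isUnit_natCast, map_one]

end GAlg

/-- Every decomposition of `1` into a finite sum can be weighted by orthogonal idempotents so as to
become a unit. Local rings and their products have this property, which forces invertible modules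
to be free. -/
def SelectsUnits (R : Type u) [CommRing R] : Prop :=
  ∀ {ι : Type u} (I : Finset ι) (r : ι → R), ∑ i ∈ I, r i = 1 →
    ∃ c : ι → R, (∀ i, c i * c i = c i) ∧ (∀ i j, i ≠ j → c i * c j = 0) ∧
      IsUnit (∑ i ∈ I, c i * r i)

namespace GAlg

variable {R : Type u} [CommRing R] {G : Type w} [CommGroup G] {p : ℕ}
  {χ : G →* rootsOfUnity p R}

theorem IsGalois.exists_isUnit_isEigen (hχ : IsKummerChar χ) (hR : SelectsUnits R)
    {S : GAlg R G} (hS : S.IsGalois) : ∃ t : S.carrier, IsUnit t ∧ S.IsEigen χ 1 t := by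
  obtain ⟨I, a, b, ha, hb, hab⟩ := hS.exists_sum_mul_eq_one hχ
  have hr (i) : ∃ r : R, algebraMap R S.carrier r = a i * b i :=
    hS.invariantsEqBase.mem_range (χ := χ) (by
      have := (ha i).mul (hb i)
      rwa [add_neg_cancel] at this)
  choose r hr using hr
  obtain ⟨c, hc, hcc, hu⟩ := hR I r (hS.injective (by rw [map_sum, map_one, ← hab]; simp_rw [hr]))
  refine ⟨∑ i ∈ I, c i • a i, ?_, IsEigen.sum _ fun i _ => (ha i).smul _⟩
  have hmul : (∑ i ∈ I, c i • a i) * (∑ i ∈ I, c i • b i) =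
      algebraMap R S.carrier (∑ i ∈ I, c i * r i) := by
    rw [Finset.sum_mul_sum, map_sum]
    refine Finset.sum_congr rfl fun i hi => ?_
    rw [Finset.sum_eq_single_of_mem i hi]
    · rw [smul_mul_smul_comm, hc, ← hr, Algebra.smul_def, ← map_mul]
    · intro j _ hj
      rw [smul_mul_smul_comm, hcc i j hj.symm, zero_smul]
  exact isUnit_of_mul_isUnit_left (hmul ▸ hu.map _)

theorem IsGalois.exists_kummer_iso (hχ : IsKummerChar χ) (hR : SelectsUnits R)
    {S : GAlg R G} (hS : S.IsGalois) : ∃ u : Rˣ, (kummer p χ u).Iso S := by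
  obtain ⟨t, ht, hte⟩ := hS.exists_isUnit_isEigen hχ hR
  have hinv (n : ℤ) (s : S.carrier) (hs : S.IsEigen χ n s) (hn : (p : ℤ) ∣ n) :
      ∃ r, algebraMap R S.carrier r = s := by
    obtain ⟨m, rfl⟩ := hn
    refine hS.invariants s fun g => ?_
    have : charPow χ (p * m) g = 1 := by
      have h1 : (χ g : Rˣ) ^ p = 1 := (mem_rootsOfUnity p _).1 (χ g).2
      rw [charPow, zpow_mul, zpow_natCast, h1, one_zpow, Units.val_one]
    rw [hs g, this, one_smul]
  obtain ⟨t, rfl⟩ := ht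
  obtain ⟨r, hr⟩ := hinv p _ (hte.pow p) dvd_rfl
  obtain ⟨r', hr'⟩ := hinv (-p) _ (IsEigen.inv (t := t ^ p) (by
    rw [Units.val_pow_eq_pow_val]; exact hte.pow p)) (by simp)
  have h1 : r * r' = 1 := hS.injective (by
    rw [map_mul, hr, hr', ← Units.val_pow_eq_pow_val, Units.mul_inv, map_one])
  exact ⟨⟨r, r', h1, by rw [mul_comm, h1]⟩,
    kummer_iso _ hχ hS.invariantsEqBase t.isUnit hte hr.symm⟩

end GAlg

/-! ### Harrison products and base changes of Kummer extensions -/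

namespace GAlg

variable {R : Type u} [CommRing R] {G : Type w} [CommGroup G] {p : ℕ}
  {χ : G →* rootsOfUnity p R}

section Averaging

variable [Fintype G] {M : Type*} [AddCommGroup M] [Module R M]

theorem rTensor_eigenProj_zero_eq (hχ : IsKummerChar χ) (S : GAlg R G) {z : S.carrier ⊗[R] M}
    (hz : ∀ g : G, (S.act g).toLinearMap.rTensor M z = z) :
    (S.eigenProj χ 0).rTensor M z = z := by
  rw [eigenProj, ← LinearMap.coe_rTensorHom, map_smul, map_sum, LinearMap.smul_apply,
    LinearMap.sum_apply]
  simp_rw [neg_zero, charPow_zero, one_smul, LinearMap.coe_rTensorHom, hz]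
  rw [Finset.sum_const, Finset.card_univ, ← Nat.card_eq_fintype_card, hχ.card,
    ← Nat.cast_smul_eq_nsmul R, smul_smul, Ring.inverse_mul_cancel _ hχ.isUnit_natCast, one_smul]

theorem lTensor_eigenProj_zero_eq (hχ : IsKummerChar χ) (S : GAlg R G) {z : M ⊗[R] S.carrier}
    (hz : ∀ g : G, (S.act g).toLinearMap.lTensor M z = z) :
    (S.eigenProj χ 0).lTensor M z = z := by
  rw [eigenProj, ← LinearMap.coe_lTensorHom, map_smul, map_sum, LinearMap.smul_apply,
    LinearMap.sum_apply]
  simp_rw [neg_zero, charPow_zero, one_smul, LinearMap.coe_lTensorHom, hz]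
  rw [Finset.sum_const, Finset.card_univ, ← Nat.card_eq_fintype_card, hχ.card,
    ← Nat.cast_smul_eq_nsmul R, smul_smul, Ring.inverse_mul_cancel _ hχ.isUnit_natCast, one_smul]

end Averaging

/-- Invariants of `S · T` are fixed by both factors of `G × G`, so they are fixed by the tensor
product of the averaging projections of `S` and `T`, whose image is `R`. -/
theorem InvariantsEqBase.harrisonProd (hχ : IsKummerChar χ) {S T : GAlg R G}
    (hS : S.InvariantsEqBase) (hT : T.InvariantsEqBase) :
    (harrisonProd S T).InvariantsEqBase := by
  have := hχ.finite
  have := Fintype.ofFinite G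
  obtain ⟨ρ, hρ, hρ1⟩ := hS.exists_retraction hχ
  obtain ⟨τ, hτ, hτ1⟩ := hT.exists_retraction hχ
  let L : S.carrier ⊗[R] T.carrier →ₗ[R] R := LinearMap.mul' R R ∘ₗ TensorProduct.map ρ τ
  have hL (s : S.carrier) (t : T.carrier) : L (s ⊗ₜ[R] t) = ρ s * τ t := by simp [L]
  constructor
  · intro a b hab
    have h1 : algebraMap R (S.carrier ⊗[R] T.carrier) a = algebraMap R _ b :=
      congrArg Subtype.val hab
    have h2 (r : R) : L (algebraMap R _ r) = r := by
      rw [Algebra.TensorProduct.algebraMap_apply, hL, hρ1,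
        ← map_one (algebraMap R T.carrier), hτ1, mul_one]
    rw [← h2 a, h1, h2]
  · intro z hz
    change harrisonSubalgebra S T at z
    have hl (g : G) : (S.act g).toLinearMap.rTensor T.carrier z.1 = z.1 :=
      congrArg Subtype.val (hz g)
    have hr (g : G) : (T.act g).toLinearMap.lTensor S.carrier z.1 = z.1 := by
      have h1 := z.2 g⁻¹
      rw [inv_inv] at h1
      have h2 : Algebra.TensorProduct.map (S.act g⁻¹) (T.act g) z.1 =
          (T.act g).toLinearMap.lTensor S.carrier
            ((S.act g⁻¹).toLinearMap.rTensor T.carrier z.1) := by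
        rw [← LinearMap.comp_apply, LinearMap.lTensor_comp_rTensor]
        rfl
      rwa [h2, hl] at h1
    have key (y : S.carrier ⊗[R] T.carrier) : (T.eigenProj χ 0).lTensor S.carrier
        ((S.eigenProj χ 0).rTensor T.carrier y) = algebraMap R _ (L y) := by
      induction y using TensorProduct.induction_on with
      | zero => simp
      | tmul s t =>
        rw [LinearMap.rTensor_tmul, LinearMap.lTensor_tmul, hL, ← hρ, ← hτ, map_mul,
          Algebra.TensorProduct.algebraMap_apply, Algebra.TensorProduct.algebraMap_apply',
          Algebra.TensorProduct.tmul_mul_tmul, mul_one, one_mul]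
      | add x y hx hy => rw [map_add, map_add, hx, hy, map_add, map_add]
    refine ⟨L z.1, Subtype.ext ?_⟩
    change algebraMap R (S.carrier ⊗[R] T.carrier) (L z.1) = z.1
    rw [← key, rTensor_eigenProj_zero_eq hχ S hl, lTensor_eigenProj_zero_eq hχ T hr]

/-- The product of the classes of `T` is an invertible element of the `χ`-eigenspace of
`R{u} · R{v}`, with `p`-th power `uv`. -/
theorem kummer_mul_iso (hχ : IsKummerChar χ) (u v : Rˣ) :
    (kummer p χ (u * v)).Iso (harrisonProd (kummer p χ u) (kummer p χ v)) := by
  let S := (kummer p χ u)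
  let T := (kummer p χ v)
  have hB := (invariantsEqBase_kummer u hχ).harrisonProd hχ (invariantsEqBase_kummer v hχ)
  let w : S.carrier ⊗[R] T.carrier := kummerRoot χ u ⊗ₜ[R] kummerRoot χ v
  have hwmem : w ∈ harrisonSubalgebra S T := by
    intro g
    rw [Algebra.TensorProduct.map_tmul, act_apply, act_apply, isEigen_kummerRoot χ u,
      isEigen_kummerRoot χ v, TensorProduct.smul_tmul_smul, charPow_inv, mul_comm,
      charPow_neg_mul, one_smul]
  let t : (harrisonProd S T).carrier := (⟨w, hwmem⟩ : harrisonSubalgebra S T)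
  have htp : t ^ p = algebraMap R (harrisonProd S T).carrier ((u * v : Rˣ) : R) := by
    refine Subtype.ext ?_
    change w ^ p = algebraMap R (S.carrier ⊗[R] T.carrier) ((u * v : Rˣ) : R)
    rw [Algebra.TensorProduct.tmul_pow, kummerRoot_pow, kummerRoot_pow, Units.val_mul, map_mul,
      Algebra.TensorProduct.algebraMap_apply, Algebra.TensorProduct.algebraMap_apply',
      Algebra.TensorProduct.tmul_mul_tmul, mul_one, one_mul]
  refine kummer_iso _ hχ hB (t := t) ?_ ?_ htp
  · rw [← isUnit_pow_iff hχ.prime.ne_zero, htp]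
    exact (u * v).isUnit.map _
  · intro g
    refine Subtype.ext ?_
    change Algebra.TensorProduct.map (S.act g) (AlgHom.id R T.carrier) w = charPow χ 1 g • w
    rw [Algebra.TensorProduct.map_tmul, act_apply, isEigen_kummerRoot χ u,
      ← TensorProduct.smul_tmul']
    rfl

theorem InvariantsEqBase.baseChange (hχ : IsKummerChar χ) {S : GAlg R G}
    (hS : S.InvariantsEqBase) (R' : Type u) [CommRing R'] [Algebra R R'] :
    (S.baseChange R').InvariantsEqBase := by
  have := hχ.finite
  have := Fintype.ofFinite G
  obtain ⟨ρ, hρ, hρ1⟩ := hS.exists_retraction hχ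
  let L : R' ⊗[R] S.carrier →ₗ[R] R' := (TensorProduct.rid R R').toLinearMap ∘ₗ ρ.lTensor R'
  have hL (r : R') (s : S.carrier) : L (r ⊗ₜ[R] s) = ρ s • r := by simp [L]
  constructor
  · intro a b hab
    have hab : algebraMap R' (R' ⊗[R] S.carrier) a = algebraMap R' (R' ⊗[R] S.carrier) b := hab
    have h2 (r : R') : L (algebraMap R' (R' ⊗[R] S.carrier) r) = r := by
      rw [Algebra.TensorProduct.algebraMap_apply, hL, Algebra.algebraMap_self_apply,
        ← map_one (algebraMap R S.carrier), hρ1, one_smul]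
    rw [← h2 a, hab, h2]
  · intro z hz
    change R' ⊗[R] S.carrier at z
    have hr (g : G) : (S.act g).toLinearMap.lTensor R' z = z := hz g
    have key (y : R' ⊗[R] S.carrier) :
        algebraMap R' (R' ⊗[R] S.carrier) (L y) = (S.eigenProj χ 0).lTensor R' y := by
      induction y using TensorProduct.induction_on with
      | zero => simp
      | tmul r s =>
        rw [LinearMap.lTensor_tmul, hL, ← hρ, Algebra.TensorProduct.algebraMap_apply,
          Algebra.algebraMap_self_apply, Algebra.algebraMap_eq_smul_one (ρ s),
          TensorProduct.smul_tmul]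
      | add x y hx hy => rw [map_add, map_add, map_add, hx, hy]
    exact ⟨L z, (key z).trans (lTensor_eigenProj_zero_eq hχ S hr)⟩

theorem kummer_baseChange_iso (hχ : IsKummerChar χ) (R' : Type u) [CommRing R'] [Algebra R R']
    {χ' : G →* rootsOfUnity p R'} (hχ' : IsKummerChar χ')
    (hcompat : ∀ g, charPow χ' 1 g = algebraMap R R' (charPow χ 1 g)) (u : Rˣ) :
    (kummer p χ' (Units.map (algebraMap R R' : R →* R') u)).Iso ((kummer p χ u).baseChange R') := by
  let S := kummer p χ u
  have hB := (invariantsEqBase_kummer u hχ).baseChange hχ R'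
  let t : (S.baseChange R').carrier := ((1 : R') ⊗ₜ[R] kummerRoot χ u : R' ⊗[R] S.carrier)
  have htp : t ^ p = algebraMap R' (S.baseChange R').carrier
      ((Units.map (algebraMap R R' : R →* R') u : R'ˣ) : R') := by
    change ((1 : R') ⊗ₜ[R] kummerRoot χ u : R' ⊗[R] S.carrier) ^ p =
      algebraMap R' (R' ⊗[R] S.carrier) (algebraMap R R' u)
    rw [Algebra.TensorProduct.tmul_pow, one_pow, kummerRoot_pow,
      Algebra.TensorProduct.algebraMap_apply, Algebra.algebraMap_self_apply,
      Algebra.algebraMap_eq_smul_one, Algebra.algebraMap_eq_smul_one, TensorProduct.smul_tmul]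
  refine kummer_iso _ hχ' hB (t := t) ?_ ?_ htp
  · rw [← isUnit_pow_iff hχ.prime.ne_zero, htp]
    exact Units.isUnit _ |>.map _
  · intro g
    change (1 : R') ⊗ₜ[R] (g • kummerRoot χ u) =
      charPow χ' 1 g • ((1 : R') ⊗ₜ[R] kummerRoot χ u : R' ⊗[R] S.carrier)
    rw [isEigen_kummerRoot χ u, hcompat, algebraMap_smul, TensorProduct.tmul_smul]

end GAlg

/-! ### The Kummer isomorphism onto the Harrison group -/

section KummerEquiv

variable {R : Type u} [CommRing R] {G : Type w} [CommGroup G] {p : ℕ}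
  {χ : G →* rootsOfUnity p R}

/-- The class of the Kummer extension `R{u}` in the Harrison set. -/
noncomputable def Harrison.kummer [Nontrivial R] (hχ : IsKummerChar χ) (u : Rˣ) : Harrison R G :=
  ⟨⟦GAlg.kummer p χ u⟧, _, GAlg.isGalois_kummer hχ u, rfl⟩

theorem Harrison.kummer_eq_iff [Nontrivial R] (hχ : IsKummerChar χ) (u v : Rˣ) :
    Harrison.kummer hχ u = Harrison.kummer hχ v ↔
      (QuotientGroup.mk u : PowQuot R p) = QuotientGroup.mk v := by
  rw [QuotientGroup.eq]
  refine Subtype.ext_iff.trans (Quotient.eq.trans ((GAlg.kummer_iso_kummer_iff hχ u v).trans ?_))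
  constructor
  · rintro ⟨c, rfl⟩
    exact ⟨c⁻¹, by simp⟩
  · rintro ⟨c, hc⟩
    refine ⟨c⁻¹, ?_⟩
    have hc : c ^ p = u⁻¹ * v := hc
    rw [inv_pow, hc]
    simp

/-- The Kummer bijection from `Rˣ / Rˣᵖ` to the Harrison set. -/
noncomputable def kummerEquiv [Nontrivial R] (hχ : IsKummerChar χ) (hR : SelectsUnits R) :
    PowQuot R p ≃ Harrison R G :=
  Equiv.ofBijective
    (Quotient.lift (Harrison.kummer hχ) fun u v h =>
      (Harrison.kummer_eq_iff hχ u v).2 (Quotient.sound h))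
    ⟨by
      intro a b
      induction a using QuotientGroup.induction_on with | H u =>
      induction b using QuotientGroup.induction_on with | H v =>
      exact (Harrison.kummer_eq_iff hχ u v).1, by
      rintro ⟨_, S, hS, rfl⟩
      obtain ⟨u, hu⟩ := hS.exists_kummer_iso hχ hR
      exact ⟨QuotientGroup.mk u, Subtype.ext (Quotient.sound hu)⟩⟩

/-- The group structure on the Harrison set: the one of `Rˣ / Rˣᵖ`, since the Kummer bijection
turns products into Harrison products. -/
@[reducible] noncomputable def harrisonGroup [Nontrivial R] (hχ : IsKummerChar χ)
    (hR : SelectsUnits R) : HarrisonGroup R G :=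
  { (kummerEquiv hχ hR).symm.commGroup with
    val_mul := fun a b => by
      obtain ⟨a, rfl⟩ := (kummerEquiv hχ hR).surjective a
      obtain ⟨b, rfl⟩ := (kummerEquiv hχ hR).surjective b
      change (kummerEquiv hχ hR ((kummerEquiv hχ hR).symm (kummerEquiv hχ hR a) *
        (kummerEquiv hχ hR).symm (kummerEquiv hχ hR b))).1 = _
      rw [Equiv.symm_apply_apply, Equiv.symm_apply_apply]
      induction a using QuotientGroup.induction_on with | H u =>
      induction b using QuotientGroup.induction_on with | H v =>
      exact Quotient.sound (GAlg.kummer_mul_iso hχ u v) }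

/-- The Kummer isomorphism from `Rˣ / Rˣᵖ` to the Harrison group. -/
noncomputable def kummerMulEquiv [Nontrivial R] (hχ : IsKummerChar χ) (hR : SelectsUnits R) :
    letI := harrisonGroup hχ hR
    PowQuot R p ≃* Harrison R G :=
  letI := harrisonGroup hχ hR
  { kummerEquiv hχ hR with
    map_mul' := fun a b => by
      change _ = kummerEquiv hχ hR ((kummerEquiv hχ hR).symm (kummerEquiv hχ hR a) *
        (kummerEquiv hχ hR).symm (kummerEquiv hχ hR b))
      rw [Equiv.symm_apply_apply, Equiv.symm_apply_apply]
      rfl }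

end KummerEquiv

/-- A character into the roots of unity of a field `k` becomes a Kummer character over every ring
containing `k`. -/
theorem isKummerChar_restrict {k R : Type*} [Field k] [CommRing R] {G : Type w} [CommGroup G]
    (c : k →+* R) {p : ℕ} (hp : p.Prime) (hpk : (p : k) ≠ 0) (hG : Nat.card G = p)
    {χ : G →* rootsOfUnity p k} (hχ : χ ≠ 1) :
    IsKummerChar ((restrictRootsOfUnity c p).comp χ) where
  prime := hp
  card := hG
  isUnit_natCast := by
    have := (IsUnit.mk0 _ hpk).map c
    rwa [map_natCast] at this
  isUnit_sub_one g hg := by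
    have hker : χ.ker = ⊥ := by
      have : Fact (Nat.card G).Prime := ⟨hG.symm ▸ hp⟩
      refine (χ.ker.eq_bot_or_eq_top_of_prime_card).resolve_right fun h => hχ ?_
      exact MonoidHom.ker_eq_top_iff.1 h
    have hne : χ g ≠ 1 := fun h => hg (by
      rwa [← MonoidHom.mem_ker, hker, Subgroup.mem_bot] at h)
    have hne' : ((χ g : kˣ) : k) - 1 ≠ 0 := fun h => hne (by
      ext; simpa using sub_eq_zero.1 h)
    have := (IsUnit.mk0 _ hne').map c
    rw [map_sub, map_one] at this
    simpa [charPow] using this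

/-! ### Roots of units in complete discretely valued fields -/

namespace IsDedekindDomain.HeightOneSpectrum

variable {R K : Type*} [CommRing R] [IsDedekindDomain R] [Field K] [Algebra R K]
  [IsFractionRing R K] (v : HeightOneSpectrum R)

theorem lt_one_iff_le_exp_neg_one (x : WithZero (Multiplicative ℤ)) :
    x < 1 ↔ x ≤ WithZero.exp (-1) := by
  rcases eq_or_ne x 0 with rfl | hx
  · simp
  · rw [← WithZero.exp_log hx, ← WithZero.exp_zero, WithZero.exp_lt_exp, WithZero.exp_le_exp]
    omega

theorem mem_maximalIdeal_pow_iff (n : ℕ) (a : v.adicCompletionIntegers K) :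
    a ∈ IsLocalRing.maximalIdeal (v.adicCompletionIntegers K) ^ n ↔
      Valued.v (a : v.adicCompletion K) ≤ WithZero.exp (-(n : ℤ)) := by
  obtain ⟨π, hπ⟩ := valuedAdicCompletion_surjective K v (WithZero.exp (-1))
  have hπmem : π ∈ v.adicCompletionIntegers K := by
    rw [mem_adicCompletionIntegers, hπ, ← WithZero.exp_zero, WithZero.exp_le_exp]
    omega
  have hint := adicCompletionIntegers.integers (R := R) K v
  have hmax : IsLocalRing.maximalIdeal (v.adicCompletionIntegers K) =
      Ideal.span {(⟨π, hπmem⟩ : v.adicCompletionIntegers K)} := by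
    ext b
    rw [IsLocalRing.mem_maximalIdeal, mem_nonunits_iff,
      adicCompletionIntegers.isUnit_iff_valued_eq_one, Ideal.mem_span_singleton,
      hint.dvd_iff_le]
    change _ ↔ Valued.v b.1 ≤ Valued.v π
    rw [hπ, ← lt_one_iff_le_exp_neg_one, lt_iff_le_and_ne]
    exact ⟨fun h => ⟨b.2, h⟩, fun h => h.2⟩
  rw [hmax, Ideal.span_singleton_pow, Ideal.mem_span_singleton, hint.dvd_iff_le]
  change Valued.v a.1 ≤ Valued.v (π ^ n) ↔ _
  rw [map_pow, hπ, ← WithZero.exp_nsmul, nsmul_eq_mul, mul_neg_one]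

instance : IsTopologicalRing (v.adicCompletionIntegers K) :=
  inferInstanceAs (IsTopologicalRing (v.adicCompletionIntegers K).toSubring)

instance : IsUniformAddGroup (v.adicCompletionIntegers K) :=
  inferInstanceAs (IsUniformAddGroup (v.adicCompletionIntegers K).toSubring.toAddSubgroup)

/-- The valuation topology on the ring of integers is the adic topology, so that completeness
becomes adic completeness, to which Hensel's lemma applies. -/
theorem isAdic_maximalIdeal :
    IsAdic (IsLocalRing.maximalIdeal (v.adicCompletionIntegers K)) := by
  have hsurj := valuedAdicCompletion_surjective (R := R) K v
  rw [isAdic_iff]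
  constructor
  · intro n
    obtain ⟨π, hπ⟩ := hsurj (WithZero.exp (-(n : ℤ)))
    have h : ((IsLocalRing.maximalIdeal (v.adicCompletionIntegers K) ^ n : Ideal _) :
        Set (v.adicCompletionIntegers K)) =
        Subtype.val ⁻¹' {a : v.adicCompletion K |
          Valued.v.restrict a ≤ Valued.v.restrict π} := by
      ext a
      rw [SetLike.mem_coe, mem_maximalIdeal_pow_iff, ← hπ, Set.mem_preimage, Set.mem_ofPred_eq,
        Valuation.restrict_le_iff]
    rw [h]
    refine (Valued.isOpen_closedBall _ ?_).preimage continuous_subtype_val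
    intro h0
    have : Valued.v π = 0 := by simpa using h0
    rw [hπ] at this
    exact WithZero.exp_ne_zero this
  · intro s hs
    rw [nhds_subtype_eq_comap, Filter.mem_comap] at hs
    obtain ⟨t, ht, hts⟩ := hs
    rw [ZeroMemClass.coe_zero, Valued.mem_nhds_zero] at ht
    obtain ⟨γ, hγ⟩ := ht
    have hγ0 : MonoidWithZeroHom.ValueGroup₀.embedding γ.1 ≠
        (0 : WithZero (Multiplicative ℤ)) := by
      simp
    refine ⟨(1 - WithZero.log (MonoidWithZeroHom.ValueGroup₀.embedding γ.1)).toNat,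
      fun a ha => hts (hγ ?_)⟩
    rw [SetLike.mem_coe, mem_maximalIdeal_pow_iff] at ha
    rw [Set.mem_ofPred_eq, Valuation.restrict_lt_iff_lt_embedding]
    refine ha.trans_lt ?_
    rw [← WithZero.exp_log hγ0, WithZero.exp_lt_exp, WithZero.log_exp]
    omega

instance isAdicComplete_maximalIdeal :
    IsAdicComplete (IsLocalRing.maximalIdeal (v.adicCompletionIntegers K))
      (v.adicCompletionIntegers K) := by
  rw [(isAdic_maximalIdeal v).isAdicComplete_iff]
  refine ⟨?_, inferInstance⟩
  exact (Valued.isClosed_valuationSubring (v.adicCompletion K)).completeSpace_coe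

/-- Hensel's lemma for `Tⁿ - u`: if `n` is a unit, then a unit `u` which is an `n`-th power up to an
element of valuation less than `1` is an `n`-th power. -/
theorem exists_pow_eq {n : ℕ} (hn0 : n ≠ 0) (hn : Valued.v (n : v.adicCompletion K) = 1)
    {u c : v.adicCompletion K} (hu : Valued.v u = 1) (hc : Valued.v (u - c ^ n) < 1) :
    ∃ y : v.adicCompletion K, y ^ n = u := by
  have hcn : Valued.v (c ^ n) = 1 := by
    have := Valuation.map_sub_eq_of_lt_right Valued.v (x := u - c ^ n) (y := u) (by rwa [hu])
    rw [sub_sub_cancel_left, Valuation.map_neg] at this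
    rw [this, hu]
  have hcv : Valued.v c = 1 := by
    rw [map_pow] at hcn
    exact (pow_eq_one_iff_of_nonneg zero_le hn0).1 hcn
  let u' : v.adicCompletionIntegers K := ⟨u, hu.le⟩
  let c' : v.adicCompletionIntegers K := ⟨c, hcv.le⟩
  have hunit : IsUnit ((n : v.adicCompletionIntegers K) * c' ^ (n - 1)) := by
    rw [adicCompletionIntegers.isUnit_iff_valued_eq_one]
    change Valued.v ((n : v.adicCompletion K) * c ^ (n - 1)) = 1
    rw [map_mul, hn, map_pow, hcv, one_pow, one_mul]
  obtain ⟨y, hy, -⟩ := HenselianRing.is_henselian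
    (I := IsLocalRing.maximalIdeal (v.adicCompletionIntegers K))
    (Polynomial.X ^ n - Polynomial.C u') (Polynomial.monic_X_pow_sub_C _ hn0) c' (by
      rw [← pow_one (IsLocalRing.maximalIdeal _), mem_maximalIdeal_pow_iff, Nat.cast_one,
        ← lt_one_iff_le_exp_neg_one]
      simp only [Polynomial.eval_sub, Polynomial.eval_pow, Polynomial.eval_X, Polynomial.eval_C]
      change Valued.v (c ^ n - u) < 1
      rwa [Valuation.map_sub_swap]) (by
      refine IsUnit.map _ ?_
      simpa [Polynomial.derivative_X_pow] using hunit)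
  refine ⟨y.1, ?_⟩
  rw [Polynomial.IsRoot.def, Polynomial.eval_sub, Polynomial.eval_pow, Polynomial.eval_X,
    Polynomial.eval_C, sub_eq_zero] at hy
  exact congrArg Subtype.val hy

end IsDedekindDomain.HeightOneSpectrum

/-! ### The local fields of a curve -/

namespace AlgebraicGeometry.Curve

section Residue

variable {X : Scheme.{u}} {k : Type u} [Field k] (f : X ⟶ Spec (CommRingCat.of k))

theorem fromSpecStalk_comp (x : X) :
    X.fromSpecStalk x ≫ f = Spec.map ((Scheme.ΓSpecIso (CommRingCat.of k)).inv ≫ f.appTop ≫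
      X.presheaf.germ ⊤ x trivial) := by
  have h := Scheme.toSpecΓ_naturality f
  rw [Spec.map_comp, Spec.map_comp, ← X.fromSpecStalk_toSpecΓ, Category.assoc, Category.assoc,
    ← Category.assoc X.toSpecΓ, ← h, Category.assoc, toSpecΓ_SpecMap_ΓSpecIso_inv,
    Category.comp_id]

/-- Every germ at a closed point differs from a constant by a germ vanishing there. -/
theorem exists_constStalk_sub_mem [IsAlgClosed k] [LocallyOfFiniteType f] (x : closedPoints X)
    (s : X.presheaf.stalk x.1) :
    ∃ c : k, s - constStalk f x.1 c ∈ IsLocalRing.maximalIdeal (X.presheaf.stalk x.1) := by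
  have hx : IsClosed {x.1} := x.2
  have hinv : (residueFieldIsoBase f x.1 hx).inv = ((Scheme.ΓSpecIso (CommRingCat.of k)).inv ≫
      f.appTop ≫ X.presheaf.germ ⊤ x.1 trivial) ≫ X.residue x.1 := by
    apply Spec.map_injective
    rw [SpecMap_residueFieldIsoBase_inv, Spec.map_comp, ← fromSpecStalk_comp,
      Scheme.fromSpecResidueField, Category.assoc]
  refine ⟨(residueFieldIsoBase f x.1 hx).hom (X.residue x.1 s), ?_⟩
  rw [← IsLocalRing.residue_eq_zero_iff, map_sub, sub_eq_zero]
  have h1 : ((residueFieldIsoBase f x.1 hx).hom ≫ (residueFieldIsoBase f x.1 hx).inv)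
      (X.residue x.1 s) = X.residue x.1 s := by
    rw [Iso.hom_inv_id]; rfl
  rw [hinv] at h1
  exact h1.symm

end Residue

variable {X : Scheme.{u}} [IsNonsingularCurve X]

/-- The discrete valuation ring `𝒪ₓ` has only one place. -/
theorem place_eq (x : closedPoints X) (v : HeightOneSpectrum (X.presheaf.stalk x.1)) :
    v = place X x :=
  HeightOneSpectrum.ext (IsLocalRing.eq_maximalIdeal (v.isPrime.isMaximal v.ne_bot))

variable {k : Type u} [Field k] (f : X ⟶ Spec (CommRingCat.of k))

theorem valued_constK (x : closedPoints X) {c : k} (hc : c ≠ 0) : Valued.v (constK f x c) = 1 := by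
  exact HeightOneSpectrum.adicCompletionIntegers.isUnit_iff_valued_eq_one.1
    ((IsUnit.mk0 c hc).map (constA f x))

/-- The residue field of `Kₓ` is `k`. -/
theorem exists_valued_sub_constK_lt_one [IsAlgClosed k] [LocallyOfFiniteType f]
    (x : closedPoints X) {a : K X x} (ha : Valued.v a ≤ 1) :
    ∃ c : k, Valued.v (a - constK f x c) < 1 := by
  have hnhds : {b : K X x | Valued.v.restrict (b - a) < 1} ∈ nhds a :=
    Valued.mem_nhds.2 ⟨1, subset_rfl⟩
  obtain ⟨_, hy, y, rfl⟩ := mem_closure_iff_nhds.1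
    (HeightOneSpectrum.denseRange_algebraMap X.functionField (place X x) a) _ hnhds
  have hya : Valued.v (algebraMap X.functionField (K X x) y - a) < 1 := by
    rw [Set.mem_ofPred_eq, ← map_one (Valued.v.restrict), Valuation.restrict_lt_iff, map_one] at hy
    exact hy
  have hy1 : Valued.v (algebraMap X.functionField (K X x) y) ≤ 1 := by
    have := Valued.v.map_add (algebraMap X.functionField (K X x) y - a) a
    rw [sub_add_cancel] at this
    exact this.trans (max_le hya.le ha)
  have hy2 : (place X x).valuation X.functionField y ≤ 1 := by
    rwa [← HeightOneSpectrum.valuedAdicCompletion_eq_valuation']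
  obtain ⟨s, rfl⟩ := HeightOneSpectrum.mem_integers_of_valuation_le_one
    (R := X.presheaf.stalk x.1) X.functionField y (fun v => place_eq x v ▸ hy2)
  obtain ⟨c, hc⟩ := exists_constStalk_sub_mem f x s
  refine ⟨c, ?_⟩
  have hsc :
      Valued.v (algebraMap X.functionField (K X x) (algebraMap _ _ s) - constK f x c) < 1 := by
    have h1 : algebraMap X.functionField (K X x) (algebraMap _ _ s) - constK f x c =
        algebraMap X.functionField (K X x) (algebraMap _ _ (s - constStalk f x.1 c)) := by
      rw [map_sub, map_sub]
      rfl
    rw [h1]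
    refine (HeightOneSpectrum.valuedAdicCompletion_eq_valuation' (v := place X x) _).trans_lt ?_
    exact ((place X x).valuation_lt_one_iff_mem (K := X.functionField) _).2 hc
  rw [← sub_add_sub_cancel a (algebraMap X.functionField (K X x) (algebraMap _ _ s))]
  refine Valued.v.map_add_lt ?_ hsc
  rwa [Valuation.map_sub_swap]

/-- Units of `Aₓ` are `p`-th powers, by Hensel's lemma, as the residue field `k` is algebraically
closed and `p` is invertible in it. -/
theorem exists_pow_eq_of_valued_eq_one [IsAlgClosed k] [LocallyOfFiniteType f]
    (x : closedPoints X) {n : ℕ} (hn : (n : k) ≠ 0) {a : K X x} (ha : Valued.v a = 1) :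
    ∃ b : K X x, b ^ n = a := by
  have hn0 : n ≠ 0 := by rintro rfl; exact hn Nat.cast_zero
  obtain ⟨c, hc⟩ := exists_valued_sub_constK_lt_one f x ha.le
  obtain ⟨d, rfl⟩ := IsAlgClosed.exists_pow_nat_eq c (Nat.pos_of_ne_zero hn0)
  refine (place X x).exists_pow_eq hn0 ?_ ha (c := constK f x d) (by rwa [← map_pow])
  rw [← map_natCast (constK f x)]
  exact valued_constK f x hn

/-! ### The valuation modulo `p` -/

theorem ord_eq_zero_iff (x : closedPoints X) (a : (K X x)ˣ) :
    ord X x a = 0 ↔ Valued.v (a : K X x) = 1 := by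
  have ha : Valued.v (a : K X x) ≠ 0 := (Valuation.ne_zero_iff _).2 a.ne_zero
  rw [ord, neg_eq_zero]
  constructor
  · intro h
    rw [← WithZero.exp_log ha, h, WithZero.exp_zero]
  · intro h
    rw [h, WithZero.log_one]

/-- The valuation of `Kₓ` as a homomorphism to the integers. -/
noncomputable def ordHom (x : closedPoints X) : (K X x)ˣ →* Multiplicative ℤ where
  toFun a := Multiplicative.ofAdd (ord X x a)
  map_one' := by simp [ord]
  map_mul' a b := by
    have h (a : (K X x)ˣ) : Valued.v (a : K X x) ≠ 0 := (Valuation.ne_zero_iff _).2 a.ne_zero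
    rw [ord, ord, ord, Units.val_mul, map_mul, WithZero.log_mul (h a) (h b), neg_add, ofAdd_add]

theorem ord_mul (x : closedPoints X) (a b : (K X x)ˣ) :
    ord X x (a * b) = ord X x a + ord X x b :=
  congrArg Multiplicative.toAdd (map_mul (ordHom x) a b)

theorem ord_one (x : closedPoints X) : ord X x 1 = 0 :=
  congrArg Multiplicative.toAdd (map_one (ordHom x))

theorem ord_inv (x : closedPoints X) (a : (K X x)ˣ) : ord X x a⁻¹ = -ord X x a :=
  congrArg Multiplicative.toAdd (map_inv (ordHom x) a)

theorem ord_zpow (x : closedPoints X) (a : (K X x)ˣ) (m : ℤ) :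
    ord X x (a ^ m) = m * ord X x a :=
  congrArg Multiplicative.toAdd (map_zpow (ordHom x) a m)

theorem ord_pow (x : closedPoints X) (a : (K X x)ˣ) (m : ℕ) :
    ord X x (a ^ m) = m * ord X x a := by
  rw [← zpow_natCast, ord_zpow]

theorem exists_ord_eq (x : closedPoints X) (m : ℤ) : ∃ a : (K X x)ˣ, ord X x a = m := by
  obtain ⟨a, ha⟩ := (place X x).valuedAdicCompletion_surjective X.functionField
    (WithZero.exp (-m))
  have ha0 : a ≠ 0 := by
    rintro rfl
    rw [map_zero] at ha
    exact WithZero.exp_ne_zero ha.symm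
  refine ⟨Units.mk0 a ha0, ?_⟩
  rw [ord, Units.val_mk0, ha, WithZero.log_exp, neg_neg]

/-- An element of `Kₓ` is a `p`-th power if and only if its valuation is divisible by `p`. -/
theorem exists_pow_eq_iff_dvd_ord [IsAlgClosed k] [LocallyOfFiniteType f]
    (x : closedPoints X) {n : ℕ} (hn : (n : k) ≠ 0) (a : (K X x)ˣ) :
    (∃ b : (K X x)ˣ, b ^ n = a) ↔ (n : ℤ) ∣ ord X x a := by
  have hn0 : n ≠ 0 := by rintro rfl; exact hn Nat.cast_zero
  constructor
  · rintro ⟨b, rfl⟩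
    rw [ord_pow]
    exact dvd_mul_right _ _
  · rintro ⟨m, hm⟩
    obtain ⟨c, hc⟩ := exists_ord_eq x m
    have h1 : ord X x (a * (c ^ n)⁻¹) = 0 := by
      rw [ord_mul, ord_inv, ord_pow, hm, hc, add_neg_cancel]
    obtain ⟨b, hb⟩ := exists_pow_eq_of_valued_eq_one f x hn ((ord_eq_zero_iff x _).1 h1)
    have hbu : IsUnit b := by
      rw [← isUnit_pow_iff hn0, hb]
      exact Units.isUnit _
    obtain ⟨b, rfl⟩ := hbu
    refine ⟨b * c, ?_⟩
    rw [mul_pow, ← eq_mul_inv_iff_mul_eq]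
    exact Units.ext (by rw [← hb, Units.val_pow_eq_pow_val])

/-- The valuation modulo `p` on `Kₓˣ`, as a homomorphism. -/
noncomputable def ordMod (p : ℕ) (x : closedPoints X) : (K X x)ˣ →* Multiplicative (ZMod p) :=
  (AddMonoidHom.toMultiplicative (Int.castAddHom (ZMod p))).comp (ordHom x)

theorem ordMod_eq_one_iff (p : ℕ) (x : closedPoints X) (a : (K X x)ˣ) :
    ordMod p x a = 1 ↔ (p : ℤ) ∣ ord X x a := by
  rw [← ZMod.intCast_zmod_eq_zero_iff_dvd]
  rfl

end AlgebraicGeometry.Curve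

/-- A surjective homomorphism from `Rˣ` whose kernel consists of the `p`-th powers identifies
`Rˣ / Rˣᵖ` with its target. -/
noncomputable def PowQuot.equivOfSurjective {R : Type u} [CommRing R] {p : ℕ} {H : Type*} [Group H]
    (φ : Rˣ →* H) (hφ : Function.Surjective φ)
    (hker : ∀ a, φ a = 1 ↔ ∃ b : Rˣ, b ^ p = a) : PowQuot R p ≃* H :=
  (QuotientGroup.quotientMulEquivOfEq (by
    ext a
    exact (hker a).symm)).trans (QuotientGroup.quotientKerEquivOfSurjective φ hφ)

namespace AlgebraicGeometry.Curve

variable {X : Scheme.{u}} [IsNonsingularCurve X]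
variable {k : Type u} [Field k] (f : X ⟶ Spec (CommRingCat.of k))

/-- The valuation modulo `p` as an isomorphism `Kₓˣ / Kₓˣᵖ ≃ ℤ/p`. -/
noncomputable def ordModEquiv [IsAlgClosed k] [LocallyOfFiniteType f] {p : ℕ} (hp : (p : k) ≠ 0)
    (x : closedPoints X) : PowQuot (K X x) p ≃* Multiplicative (ZMod p) :=
  PowQuot.equivOfSurjective (ordMod p x)
    (fun m => by
      obtain ⟨n, hn⟩ := ZMod.intCast_surjective m.toAdd
      obtain ⟨a, ha⟩ := exists_ord_eq x n
      exact ⟨a, congrArg Multiplicative.ofAdd ((congrArg Int.cast ha).trans hn)⟩)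
    (fun a => by rw [ordMod_eq_one_iff, exists_pow_eq_iff_dvd_ord f x hp])

/-! ### The adele ring -/

theorem isUnit_adele_iff {a : Adele X} :
    IsUnit a ↔ (∀ x, a x ≠ 0) ∧ ∀ᶠ x in Filter.cofinite, Valued.v (a x) = 1 := by
  constructor
  · rintro ⟨a, rfl⟩
    have h (x : closedPoints X) : (a : Adele X) x * ((a⁻¹ : (Adele X)ˣ) : Adele X) x = 1 := by
      rw [← RestrictedProduct.mul_apply, Units.mul_inv, RestrictedProduct.one_apply]
    refine ⟨fun x => left_ne_zero_of_mul_eq_one (h x), ?_⟩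
    filter_upwards [(a : Adele X).eventually, ((a⁻¹ : (Adele X)ˣ) : Adele X).eventually]
      with x hx hx'
    have hx : Valued.v ((a : Adele X) x) ≤ 1 := hx
    have hx' : Valued.v (((a⁻¹ : (Adele X)ˣ) : Adele X) x) ≤ 1 := hx'
    refine le_antisymm hx ?_
    have h1 := congrArg Valued.v (h x)
    rw [map_mul, map_one] at h1
    rw [← h1]
    exact mul_le_of_le_one_right' hx'
  · rintro ⟨h0, h1⟩
    have hmem : ∀ᶠ x in Filter.cofinite, (a x)⁻¹ ∈ (A X x : Set (K X x)) := by
      filter_upwards [h1] with x hx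
      change Valued.v (a x)⁻¹ ≤ 1
      rw [map_inv₀, hx, inv_one]
    refine IsUnit.of_mul_eq_one (RestrictedProduct.mk _ hmem) ?_
    refine RestrictedProduct.ext _ _ fun x => ?_
    rw [RestrictedProduct.mul_apply, RestrictedProduct.mk_apply, mul_inv_cancel₀ (h0 x),
      RestrictedProduct.one_apply]

/-- At each place some summand of a decomposition of `1` has valuation at least `1`, and selecting
one such summand at every place gives a unit, since almost everywhere all of them are integral. -/
theorem selectsUnits_adele : SelectsUnits (Adele X) := by
  classical
  intro ι I r hr
  have hex (x : closedPoints X) : ∃ i ∈ I, 1 ≤ Valued.v (r i x) := by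
    by_contra! h
    have h1 : ∑ i ∈ I, r i x = 1 := by
      have := congrArg (proj X x) hr
      rwa [map_sum, map_one] at this
    have h2 := Valued.v.map_sum_lt one_ne_zero h
    rw [h1, map_one] at h2
    exact lt_irrefl _ h2
  choose i hi hri using hex
  let c (j : ι) : Adele X :=
    ⟨fun x => if j = i x then 1 else 0, Filter.Eventually.of_forall fun x => by
    change (if j = i x then 1 else 0) ∈ A X x
    split_ifs
    · exact one_mem _
    · exact zero_mem _⟩
  have hc (j : ι) (x : closedPoints X) : c j x = if j = i x then 1 else 0 := rfl
  have hsum (x : closedPoints X) : (∑ j ∈ I, c j * r j) x = r (i x) x := by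
    have h1 : (∑ j ∈ I, c j * r j) x = ∑ j ∈ I, c j x * r j x := by
      change proj X x (∑ j ∈ I, c j * r j) = _
      rw [map_sum]
      rfl
    rw [h1, Finset.sum_eq_single_of_mem (i x) (hi x)]
    · rw [hc, if_pos rfl, one_mul]
    · intro j _ hj
      rw [hc, if_neg hj, zero_mul]
  refine ⟨c, fun j => ?_, fun j l hjl => ?_, isUnit_adele_iff.2 ⟨fun x h0 => ?_, ?_⟩⟩
  · refine RestrictedProduct.ext _ _ fun x => ?_
    rw [RestrictedProduct.mul_apply, hc]
    split_ifs <;> simp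
  · refine RestrictedProduct.ext _ _ fun x => ?_
    rw [RestrictedProduct.mul_apply, hc, hc]
    change _ = (0 : K X x)
    split_ifs with h1 h2
    · exact absurd (h1.trans h2.symm) hjl
    all_goals simp
  · have := hri x
    rw [← hsum x, h0, map_zero] at this
    exact absurd this (by simp)
  · have hint : ∀ᶠ x in Filter.cofinite, ∀ j ∈ I, r j x ∈ (A X x : Set (K X x)) :=
      (Filter.eventually_all_finset I).2 fun j _ => (r j).eventually
    filter_upwards [hint] with x hx
    rw [hsum x]
    exact le_antisymm (hx (i x) (hi x)) (hri x)

end AlgebraicGeometry.Curve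

theorem selectsUnits_field (F : Type u) [Field F] : SelectsUnits F := by
  classical
  intro ι I r hr
  obtain ⟨i, hi, hri⟩ := Finset.exists_ne_zero_of_sum_ne_zero (hr ▸ one_ne_zero)
  refine ⟨Pi.single i 1, fun j => ?_, fun j l hjl => ?_, ?_⟩
  · rcases eq_or_ne j i with rfl | h <;> simp [*]
  · rcases eq_or_ne j i with rfl | h
    · simp [Pi.single_eq_of_ne hjl.symm]
    · simp [h]
  · rw [Finset.sum_eq_single_of_mem i hi fun j _ hj => by rw [Pi.single_eq_of_ne hj, zero_mul],
      Pi.single_eq_same, one_mul]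
    exact hri.isUnit

namespace AlgebraicGeometry.Curve

variable {X : Scheme.{u}} [IsNonsingularCurve X]
variable {k : Type u} [Field k] (f : X ⟶ Spec (CommRingCat.of k))

/-- A curve of finite type has a closed point, so its adele ring is not the zero ring. -/
theorem nontrivial_adele [QuasiCompact f] : Nontrivial (Adele X) := by
  have : CompactSpace X := QuasiCompact.compactSpace_of_compactSpace f
  obtain ⟨x, -, hx⟩ := (isClosed_univ (X := X)).exists_closed_singleton Set.univ_nonempty
  exact (proj X ⟨x, hx⟩).domain_nontrivial

/-- An idele is a `p`-th power if and only if its valuation is divisible by `p` everywhere. -/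
theorem exists_pow_eq_iff_forall_dvd_ord [IsAlgClosed k] [LocallyOfFiniteType f] {n : ℕ}
    (hn : (n : k) ≠ 0) (a : (Adele X)ˣ) :
    (∃ b : (Adele X)ˣ, b ^ n = a) ↔
      ∀ x, (n : ℤ) ∣ ord X x (Units.map (proj X x : Adele X →* K X x) a) := by
  have hn0 : n ≠ 0 := by rintro rfl; exact hn Nat.cast_zero
  constructor
  · rintro ⟨b, rfl⟩ x
    rw [← exists_pow_eq_iff_dvd_ord f x hn, map_pow]
    exact ⟨_, rfl⟩
  · intro h
    have hb (x) := (exists_pow_eq_iff_dvd_ord f x hn _).2 (h x)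
    choose b hb using hb
    have hb' (x : closedPoints X) : (b x : K X x) ^ n = (a : Adele X) x := by
      rw [← Units.val_pow_eq_pow_val, hb]
      rfl
    have hval : ∀ᶠ x in Filter.cofinite, Valued.v (b x : K X x) = 1 := by
      filter_upwards [(isUnit_adele_iff.1 a.isUnit).2] with x hx
      rw [← hb', map_pow] at hx
      exact (pow_eq_one_iff_of_nonneg zero_le hn0).1 hx
    let β : Adele X := RestrictedProduct.mk (fun x => (b x : K X x)) (hval.mono fun x hx => hx.le)
    have hβ : IsUnit β := isUnit_adele_iff.2 ⟨fun x => (b x).ne_zero, hval⟩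
    obtain ⟨γ, hγ⟩ := hβ
    refine ⟨γ, Units.ext (RestrictedProduct.ext _ _ fun x => ?_)⟩
    rw [Units.val_pow_eq_pow_val, hγ, RestrictedProduct.pow_apply]
    exact hb' x

/-- An idele has valuation zero at almost all places. -/
theorem finite_ord_ne_zero (a : (Adele X)ˣ) :
    {x | ord X x (Units.map (proj X x : Adele X →* K X x) a) ≠ 0}.Finite := by
  have h := (isUnit_adele_iff.1 a.isUnit).2
  refine Set.Finite.subset h fun x hx h1 => hx ((ord_eq_zero_iff x _).2 h1)

open Classical in
/-- The family of the valuations modulo `p` of an idele. -/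
noncomputable def adeleOrdFamily (p : ℕ) (a : (Adele X)ˣ) :
    DirectSum (closedPoints X) fun _ => ZMod p :=
  DirectSum.mk (fun _ => ZMod p) (finite_ord_ne_zero a).toFinset
    fun x => (ord X x.1 (Units.map (proj X x.1 : Adele X →* K X x.1) a) : ZMod p)

theorem adeleOrdFamily_apply (p : ℕ) (a : (Adele X)ˣ) (x : closedPoints X) :
    adeleOrdFamily p a x = (ord X x (Units.map (proj X x : Adele X →* K X x) a) : ZMod p) := by
  classical
  by_cases hx : x ∈ (finite_ord_ne_zero a).toFinset
  · exact DirectSum.mk_apply_of_mem hx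
  · refine (DirectSum.mk_apply_of_notMem hx).trans ?_
    rw [Set.Finite.mem_toFinset, Set.mem_ofPred_eq, not_not] at hx
    rw [hx, Int.cast_zero]

/-- The valuations modulo `p` on the ideles, as a homomorphism. -/
noncomputable def adeleOrdMod (p : ℕ) :
    (Adele X)ˣ →* Multiplicative (DirectSum (closedPoints X) fun _ => ZMod p) where
  toFun a := Multiplicative.ofAdd (adeleOrdFamily p a)
  map_one' := by
    refine congrArg Multiplicative.ofAdd (DFinsupp.ext fun x => ?_)
    refine (adeleOrdFamily_apply p 1 x).trans ?_
    rw [map_one, ord_one, Int.cast_zero]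
    rfl
  map_mul' a b := by
    rw [← ofAdd_add]
    refine congrArg Multiplicative.ofAdd (DFinsupp.ext fun x => ?_)
    refine Eq.trans ?_ (DirectSum.add_apply (adeleOrdFamily p a) (adeleOrdFamily p b) x).symm
    rw [adeleOrdFamily_apply, adeleOrdFamily_apply, adeleOrdFamily_apply, map_mul, ord_mul,
      Int.cast_add]

theorem adeleOrdMod_eq_one_iff (p : ℕ) (a : (Adele X)ˣ) : adeleOrdMod p a = 1 ↔
    ∀ x, (p : ℤ) ∣ ord X x (Units.map (proj X x : Adele X →* K X x) a) := by
  simp_rw [← ZMod.intCast_zmod_eq_zero_iff_dvd, ← adeleOrdFamily_apply]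
  exact DFinsupp.ext_iff

/-- A family of finite support is lifted to an idele that is `1` wherever the family vanishes. -/
theorem adeleOrdMod_surjective (p : ℕ) : Function.Surjective (adeleOrdMod (X := X) p) := by
  classical
  intro d
  have hex (x : closedPoints X) : ∃ a : (K X x)ˣ, (ord X x a : ZMod p) = d.toAdd x ∧
      (d.toAdd x = 0 → a = 1) := by
    by_cases h : d.toAdd x = 0
    · exact ⟨1, by rw [ord_one, h, Int.cast_zero], fun _ => rfl⟩
    · obtain ⟨m, hm⟩ := ZMod.intCast_surjective (d.toAdd x)
      obtain ⟨a, ha⟩ := exists_ord_eq x m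
      exact ⟨a, by rw [ha, hm], fun h' => absurd h' h⟩
  choose a ha ha1 using hex
  have hval : ∀ᶠ x in Filter.cofinite, Valued.v (a x : K X x) = 1 := by
    refine Set.Finite.subset (DFinsupp.finite_support d.toAdd) fun x hx h => hx ?_
    change Valued.v (a x : K X x) = 1
    rw [ha1 x h, Units.val_one, map_one]
  let α : Adele X := RestrictedProduct.mk (fun x => (a x : K X x)) (hval.mono fun x hx => hx.le)
  obtain ⟨β, hβ⟩ : IsUnit α := isUnit_adele_iff.2 ⟨fun x => (a x).ne_zero, hval⟩
  refine ⟨β, congrArg Multiplicative.ofAdd (DFinsupp.ext fun x => ?_)⟩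
  refine (adeleOrdFamily_apply p β x).trans ?_
  have : Units.map (proj X x : Adele X →* K X x) β = a x := Units.ext (by
    change (β : Adele X) x = a x
    rw [hβ]
    rfl)
  rw [this, ha]
  rfl

/-- The valuations modulo `p` as an isomorphism from the ideles modulo `p`-th powers. -/
noncomputable def adeleOrdModEquiv [IsAlgClosed k] [LocallyOfFiniteType f] {p : ℕ}
    (hp : (p : k) ≠ 0) :
    PowQuot (Adele X) p ≃* Multiplicative (DirectSum (closedPoints X) fun _ => ZMod p) :=
  PowQuot.equivOfSurjective (adeleOrdMod p) (adeleOrdMod_surjective p) (fun a => by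
    rw [adeleOrdMod_eq_one_iff, exists_pow_eq_iff_forall_dvd_ord f hp])

end AlgebraicGeometry.Curve

/-! ### Kummer theory of the adele ring -/

theorem theoremT {k : Type u} [Field k] [IsAlgClosed k]
    (X : Scheme.{u}) [IsNonsingularCurve X] (f : X ⟶ Spec (CommRingCat.of k)) [IsProper f]
    (p : ℕ) (hp : p.Prime) (hpk : (p : k) ≠ 0)
    (G : Type w) [CommGroup G] (hG : Nat.card G = p)
    (χ : G →* rootsOfUnity p k) (hχ : χ ≠ 1) :
    -- the Harrison sets are groups under the Harrison product
    ∃ (_ : HarrisonGroup (Adele X) G) (_ : ∀ x : closedPoints X, HarrisonGroup (K X x) G),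
    -- the horizontal isomorphisms
    ∃ (v : PowQuot (Adele X) p ≃* Multiplicative (DirectSum (closedPoints X) fun _ => ZMod p))
      (vLoc : ∀ x : closedPoints X, PowQuot (K X x) p ≃* Multiplicative (ZMod p))
      (i : PowQuot (Adele X) p ≃* Harrison (Adele X) G)
      (iLoc : ∀ x : closedPoints X, PowQuot (K X x) p ≃* Harrison (K X x) G)
    -- the vertical map on the right
      (res : Harrison (Adele X) G →* ∀ x : closedPoints X, Harrison (K X x) G),
      -- `v` and `vLoc` are the valuations modulo `p`
      (∀ (a : (Adele X)ˣ) (x : closedPoints X),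
        (v (QuotientGroup.mk a)).toAdd x = (ord X x (Units.map (proj X x : Adele X →* K X x) a) : ZMod p)) ∧
      (∀ (x : closedPoints X) (a : (K X x)ˣ),
        (vLoc x (QuotientGroup.mk a)).toAdd = (ord X x a : ZMod p)) ∧
      -- `i` and `iLoc` are the Kummer maps
      (∀ a : (Adele X)ˣ, (i (QuotientGroup.mk a)).1 =
        ⟦GAlg.kummer p ((restrictRootsOfUnity (constAdele f) p).comp χ) a⟧) ∧
      (∀ (x : closedPoints X) (a : (K X x)ˣ), (iLoc x (QuotientGroup.mk a)).1 =
        ⟦GAlg.kummer p ((restrictRootsOfUnity (constK f x) p).comp χ) a⟧) ∧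
      -- `res` is given by base change
      (∀ (c : Harrison (Adele X) G) (x : closedPoints X),
        (res c x).1 = GAlgClass.baseChange (K X x) c.1) ∧
      -- the vertical maps are injective
      Function.Injective (fun (d : DirectSum (closedPoints X) fun _ => ZMod p) (x : closedPoints X) => d x) ∧
      Function.Injective
        (fun (c : PowQuot (Adele X) p) (x : closedPoints X) => PowQuot.map (proj X x) p c) ∧
      Function.Injective res ∧
      -- the two squares commute
      (∀ (c : PowQuot (Adele X) p) (x : closedPoints X),
        (v c).toAdd x = (vLoc x (PowQuot.map (proj X x) p c)).toAdd) ∧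
      (∀ (c : PowQuot (Adele X) p) (x : closedPoints X),
        res (i c) x = iLoc x (PowQuot.map (proj X x) p c)) := by
  have := nontrivial_adele f
  have hA := isKummerChar_restrict (constAdele f) hp hpk hG hχ
  have hK (x : closedPoints X) := isKummerChar_restrict (constK f x) hp hpk hG hχ
  let gA : HarrisonGroup (Adele X) G := harrisonGroup hA selectsUnits_adele
  let gK (x : closedPoints X) : HarrisonGroup (K X x) G :=
    harrisonGroup (hK x) (selectsUnits_field _)
  let i : PowQuot (Adele X) p ≃* Harrison (Adele X) G := kummerMulEquiv hA selectsUnits_adele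
  let iLoc (x : closedPoints X) : PowQuot (K X x) p ≃* Harrison (K X x) G :=
    kummerMulEquiv (hK x) (selectsUnits_field _)
  let v : PowQuot (Adele X) p ≃* Multiplicative (DirectSum (closedPoints X) fun _ => ZMod p) :=
    adeleOrdModEquiv f hpk
  let vLoc (x : closedPoints X) : PowQuot (K X x) p ≃* Multiplicative (ZMod p) :=
    ordModEquiv f hpk x
  let res : Harrison (Adele X) G →* ∀ x : closedPoints X, Harrison (K X x) G :=
    MonoidHom.pi fun x =>
      (iLoc x).toMonoidHom.comp ((PowQuot.map (proj X x) p).comp i.symm.toMonoidHom)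
  have hv (a : (Adele X)ˣ) (x : closedPoints X) : (v (QuotientGroup.mk a)).toAdd x =
      (ord X x (Units.map (proj X x : Adele X →* K X x) a) : ZMod p) := adeleOrdFamily_apply p a x
  have hleft (c : PowQuot (Adele X) p) (x : closedPoints X) :
      (v c).toAdd x = (vLoc x (PowQuot.map (proj X x) p c)).toAdd := by
    induction c using QuotientGroup.induction_on with | H a => exact hv a x
  have hright (c : PowQuot (Adele X) p) (x : closedPoints X) :
      res (i c) x = iLoc x (PowQuot.map (proj X x) p c) := by
    change iLoc x (PowQuot.map (proj X x) p (i.symm (i c))) = _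
    rw [MulEquiv.symm_apply_apply]
  have hmid : Function.Injective
      (fun (c : PowQuot (Adele X) p) (x : closedPoints X) => PowQuot.map (proj X x) p c) := by
    intro c d hcd
    refine v.injective (congrArg Multiplicative.ofAdd (DFinsupp.ext fun x => ?_))
    refine (hleft c x).trans (Eq.trans ?_ (hleft d x).symm)
    rw [show PowQuot.map (proj X x) p c = PowQuot.map (proj X x) p d from congrFun hcd x]
  refine ⟨gA, gK, v, vLoc, i, iLoc, res, hv, fun _ _ => rfl, fun _ => rfl, fun _ _ => rfl,
    fun c x => ?_, DFunLike.coe_injective, hmid, fun c d hcd => ?_, hleft, hright⟩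
  · obtain ⟨c, rfl⟩ := i.surjective c
    rw [hright]
    induction c using QuotientGroup.induction_on with | H a =>
    exact Quotient.sound (GAlg.kummer_baseChange_iso hA (K X x) (hK x) (fun g => rfl) a)
  · obtain ⟨c, rfl⟩ := i.surjective c
    obtain ⟨d, rfl⟩ := i.surjective d
    refine congrArg i (hmid (funext fun x => (iLoc x).injective ?_))
    rw [← hright, ← hright, hcd]
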